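/- **Corollary (PWF for fixed relay precoding).** Consider a multi-hop B-MAC amplify-and-forward relay network with $L$ links and $Q\ge 1$ relay clusters: channels $\mathbf H_0^l$ (source of link $l$ to cluster $1$), $\mathbf H_q$ (cluster $q$ to $q+1$), $\mathbf H_Q^l$ (cluster $Q$ to destination of link $l$); positive semidefinite noise covariances $\mathbf W_q$ at the clusters and $\mathbf W_{Q+1}^l$ at the destinations; constraint matrices $\hat{\mathbf W}_0^l\succeq 0$, $\hat{\mathbf W}_q\succ 0$; a binary coupling matrix $\mathbf\Phi=(\phi_{l,k})$ with $\phi_{l,l}=0$; weights $w_l\ge 0$. Fix relay precoding matrices $\mathbf F=(\mathbf F_1,\dots,\mathbf F_Q)$ and put $\mathbf B_{q,q'}=\mathbf F_{q'}\mathbf H_{q'-1}\mathbf F_{q'-1}\cdots\mathbf H_q\mathbf F_q$ ($q\le q'$), $\check{\mathbf H}_{l,k}=\mathbf H_Q^l\mathbf B_{1,Q}\mathbf H_0^k$, $$\mathbf W_l'=\sum_{q=1}^Q\mathbf H_Q^l\mathbf B_{q,Q}\mathbf W_q\mathbf B_{q,Q}^\dagger\mathbf H_Q^{l\dagger}+\mathbf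 W_{Q+1}^l,\qquad \hat{\mathbf W}_l'=\sum_{q=1}^Q\mathbf H_0^{l\dagger}\mathbf B_{1,q}^\dagger\hat{\mathbf W}_q\mathbf B_{1,q}\mathbf H_0^l+\hat{\mathbf W}_0^l ,$$ and assume that $\mathbf W_l'$ and $\hat{\mathbf W}_l'$ are nonsingular for all $l$ (for instance, that all $\mathbf W_{Q+1}^l$ and $\hat{\mathbf W}_0^l$ are). For $\mathbf\Sigma=(\mathbf\Sigma_1,\dots,\mathbf\Sigma_L)$ let $\mathbf\Omega_l=\mathbf W_l'+\sum_k\phi_{l,k}\check{\mathbf H}_{l,k}\mathbf\Sigma_k\check{\mathbf H}_{l,k}^\dagger$, let $\mathbf\Sigma_q^R=\sum_l\mathbf B_{1,q}\mathbf H_0^l\mathbf\Sigma_l\mathbf H_0^{l\dagger}\mathbf B_{1,q}^\dagger+\sum_{q'\le q}\mathbf B_{q',q}\mathbf W_{q'}\mathbf B_{q',q}^\dagger$ be the covariance of the signal transmitted by cluster $q$, and let $$L_\lambda(\mathbf\Sigma,\mathbf F)=\sum_l w_l\log\bigl|\mathbf I+\check{\mathbf H}_{l,l}\mathbf\Sigma_l\check{\mathbf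 H}_{l,l}^\dagger\mathbf\Omega_l^{-1}\bigr|-\sum_l\mathrm{Tr}(\mathbf\Sigma_l\hat{\mathbf W}_0^l)-\sum_{q=1}^Q\mathrm{Tr}(\mathbf\Sigma_q^R\hat{\mathbf W}_q).$$ A family $\mathbf\Sigma$ of positive semidefinite matrices is *stationary for* $\mathbf F$ if $\nabla_{\mathbf\Sigma_l}L_\lambda(\mathbf\Sigma,\mathbf F)\preceq 0$ and $\mathrm{Tr}(\mathbf\Sigma_l\nabla_{\mathbf\Sigma_l}L_\lambda(\mathbf\Sigma,\mathbf F))=0$ for all $l$. The dual network has precoding $\hat{\mathbf F}=(\mathbf F_1^\dagger,\dots,\mathbf F_Q^\dagger)$, and for dual input covariances $\hat{\mathbf\Sigma}$ its interference-plus-noise covariances are $\hat{\mathbf\Omega}_l=\hat{\mathbf W}_l'+\sum_k\phi_{k,l}\check{\mathbf H}_{k,l}^\dagger\hat{\mathbf\Sigma}_k\check{\mathbf H}_{k,l}$. A *Type I dual transformation* of $(\mathbf\Sigma,\mathbf F)$ is $(\hat{\mathbf\Sigma},\hat{\mathbf F})$ with $\hat{\mathbf\Sigma}$ obtained as follows.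 Decompose $\mathbf\Sigma_l=\sum_{m=1}^{M_l}p_{l,m}\mathbf t_{l,m}\mathbf t_{l,m}^\dagger$ with $p_{l,m}>0$, $\|\mathbf t_{l,m}\|=1$. Let $\mathbf r_{l,m}$ be a unit vector that is a scalar multiple of $\bigl(\sum_{i>m}p_{l,i}\check{\mathbf H}_{l,l}\mathbf t_{l,i}\mathbf t_{l,i}^\dagger\check{\mathbf H}_{l,l}^\dagger+\mathbf\Omega_l\bigr)^{-1}\check{\mathbf H}_{l,l}\mathbf t_{l,m}$. Let $\mathbf\Psi_{l,m}^{k,n}$ be $0$ if $k=l$, $m\ge n$; $|\mathbf r_{l,m}^\dagger\check{\mathbf H}_{l,l}\mathbf t_{l,n}|^2$ if $k=l$, $m<n$; and $\phi_{l,k}|\mathbf r_{l,m}^\dagger\check{\mathbf H}_{l,k}\mathbf t_{k,n}|^2$ if $k\neq l$. Let $\mathbf D$ be the diagonal matrix with entries $\gamma_{l,m}/|\mathbf r_{l,m}^\dagger\check{\mathbf H}_{l,l}\mathbf t_{l,m}|^2$, where $\gamma_{l,m}=p_{l,m}|\mathbf r_{l,m}^\dagger\check{\mathbf H}_{l,l}\mathbf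 t_{l,m}|^2/\bigl(\mathbf r_{l,m}^\dagger\mathbf W_l'\mathbf r_{l,m}+\sum_{k,n}\mathbf\Psi_{l,m}^{k,n}p_{k,n}\bigr)$. With $\mathbf q=(\mathbf D^{-1}-\mathbf\Psi^T)^{-1}\hat{\mathbf n}$, $\hat n_{l,m}=\mathbf t_{l,m}^\dagger\hat{\mathbf W}_l'\mathbf t_{l,m}$, put $\hat{\mathbf\Sigma}_l=\sum_m q_{l,m}\mathbf r_{l,m}\mathbf r_{l,m}^\dagger$. Given $\mathbf\Sigma$ and $\hat{\mathbf\Sigma}$ put $\bar{\mathbf H}_l=\mathbf\Omega_l^{-1/2}\check{\mathbf H}_{l,l}\hat{\mathbf\Omega}_l^{-1/2}$, and let $\bar{\mathbf H}_l=\mathbf E_l\mathbf\Delta_l\mathbf G_l^\dagger$ be a thin SVD of size $N_l=\mathrm{rank}(\check{\mathbf H}_{l,l})$, with $\mathbf\Delta_l$ diagonal and positive. Consider the structures $$\text{(P)}\quad \hat{\mathbf\Omega}_l^{1/2}\mathbf\Sigma_l\hat{\mathbf\Omega}_l^{1/2}=\mathbf G_l(w_l\mathbf I-\mathbf\Delta_l^{-2})^+\mathbf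 G_l^\dagger\ \ \forall l,\qquad \text{(D)}\quad \mathbf\Omega_l^{1/2}\hat{\mathbf\Sigma}_l\mathbf\Omega_l^{1/2}=\mathbf E_l(w_l\mathbf I-\mathbf\Delta_l^{-2})^+\mathbf E_l^\dagger\ \ \forall l.$$ 1. Let $\bar{\mathbf\Sigma}$ be stationary for $\mathbf F$. Then $\bar{\mathbf\Sigma}$ has a stream decomposition and, for every stream decomposition, the Type I dual transformation of $(\bar{\mathbf\Sigma},\mathbf F)$ is well defined and equals $(\hat{\mathbf\Sigma},\hat{\mathbf F})$ with $$\hat{\mathbf\Sigma}_l=w_l\Bigl(\mathbf\Omega_l^{-1}-\bigl(\mathbf\Omega_l+\check{\mathbf H}_{l,l}\bar{\mathbf\Sigma}_l\check{\mathbf H}_{l,l}^\dagger\bigr)^{-1}\Bigr)\quad\forall l.\qquad(*)$$ With this $\hat{\mathbf\Sigma}$, thin SVDs of the $\bar{\mathbf H}_l$ of size $N_l$ exist, and (P) and (D) hold for every choice of them. 2. Conversely, let $\mathbf\Sigma_l\succeq 0$ for all $l$. If (P) holds for some choice of the thin SVDs, where $\hat{\mathbf\Sigma}$ is a Type I dual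 transformation of $(\mathbf\Sigma,\mathbf F)$, or is given by $(*)$ with $\mathbf\Sigma$ in place of $\bar{\mathbf\Sigma}$, or is any family of positive semidefinite matrices for which (D) also holds for some choice of the thin SVDs, then $\mathbf\Sigma$ is stationary for $\mathbf F$. -/

import Mathlib

open scoped MatrixOrder ComplexOrder

/-- A family of square complex matrices, one per link, of sizes `n l × n l`
(input covariance matrices are families of positive semidefinite ones). -/
abbrev CovFamily {L : ℕ} (n : Fin L → ℕ) : Type :=
  ∀ l : Fin L, Matrix (Fin (n l)) (Fin (n l)) ℂ

/-! ### One-hop B-MAC interference networks and the covariance transformation -/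

/-- The parameters of a one-hop B-MAC interference network: link `k` has `tx k` transmit and `rx k`
receive antennas, `H l k` is the channel from the source of link `k` to the destination of
link `l`, `W l` is the noise covariance at the destination of link `l`, `What l` is the constraint
matrix of link `l`, and `Φ` is the coupling matrix. -/
structure InterferenceNetwork {L : ℕ} (tx rx : Fin L → ℕ) where
  H : ∀ l k : Fin L, Matrix (Fin (rx l)) (Fin (tx k)) ℂ
  W : CovFamily rx
  What : CovFamily tx
  Φ : Matrix (Fin L) (Fin L) ℝ

/-- A decomposition of the input covariances into streams of positive power `p l m` along unit
vectors `t l m`. The number of streams is arbitrary, and the vectors need not be orthogonal. -/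
structure StreamDecomposition {L : ℕ} {tx : Fin L → ℕ} (S : CovFamily tx) where
  M : Fin L → ℕ
  p : ∀ l : Fin L, Fin (M l) → ℝ
  t : ∀ l : Fin L, Fin (M l) → Fin (tx l) → ℂ
  power_pos : ∀ l m, 0 < p l m
  unit_norm : ∀ l m, star (t l m) ⬝ᵥ t l m = 1
  sum_eq : ∀ l, S l = ∑ m, (p l m : ℂ) • Matrix.vecMulVec (t l m) (star (t l m))

/-- The index set of all streams of all links. -/
abbrev StreamDecomposition.Idx {L : ℕ} {tx : Fin L → ℕ} {S : CovFamily tx}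
    (dec : StreamDecomposition S) : Type :=
  Sigma fun l : Fin L => Fin (dec.M l)

namespace InterferenceNetwork

variable {L : ℕ} {tx rx : Fin L → ℕ}

/-- Interference-plus-noise covariance at the destination of link `l`. -/
noncomputable def interference (N : InterferenceNetwork tx rx) (S : CovFamily tx) :
    CovFamily rx := fun l =>
  N.W l + ∑ k, N.Φ l k • (N.H l k * S k * (N.H l k).conjTranspose)

/-- `r` is a family of unit-norm MMSE-SIC receive vectors for the given streams. -/
def IsReceiver (N : InterferenceNetwork tx rx) {S : CovFamily tx} (dec : StreamDecomposition S)
    (r : ∀ l : Fin L, Fin (dec.M l) → Fin (rx l) → ℂ) : Prop :=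
  ∀ l m,
    (∃ α : ℂ, r l m = α • Matrix.mulVec
      (∑ i ∈ Finset.Ioi m, N.H l l *
          ((dec.p l i : ℂ) • Matrix.vecMulVec (dec.t l i) (star (dec.t l i))) *
          (N.H l l).conjTranspose
        + N.interference S l)⁻¹
      (Matrix.mulVec (N.H l l) (dec.t l m))) ∧
    star (r l m) ⬝ᵥ r l m = 1

/-- The squared modulus of the gain from stream `b` to the receive vector of stream `a`. -/
noncomputable def gain (N : InterferenceNetwork tx rx) {S : CovFamily tx}
    (dec : StreamDecomposition S) (r : ∀ l : Fin L, Fin (dec.M l) → Fin (rx l) → ℂ)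
    (a b : dec.Idx) : ℝ :=
  ‖star (r a.1 a.2) ⬝ᵥ Matrix.mulVec (N.H a.1 b.1) (dec.t b.1 b.2)‖ ^ 2

/-- The cross-talk matrix between streams. Within a link, the streams are decoded and cancelled
successively. -/
noncomputable def crosstalk (N : InterferenceNetwork tx rx) {S : CovFamily tx}
    (dec : StreamDecomposition S) (r : ∀ l : Fin L, Fin (dec.M l) → Fin (rx l) → ℂ) :
    Matrix dec.Idx dec.Idx ℝ := fun a b =>
  if a.1 = b.1 then
    if (a.2 : ℕ) < (b.2 : ℕ) then N.gain dec r a b else 0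
  else N.Φ a.1 b.1 * N.gain dec r a b

/-- The signal-to-interference-plus-noise ratio of stream `a`. -/
noncomputable def sinr (N : InterferenceNetwork tx rx) {S : CovFamily tx}
    (dec : StreamDecomposition S) (r : ∀ l : Fin L, Fin (dec.M l) → Fin (rx l) → ℂ)
    (a : dec.Idx) : ℝ :=
  dec.p a.1 a.2 * N.gain dec r a a /
    ((star (r a.1 a.2) ⬝ᵥ Matrix.mulVec (N.W a.1) (r a.1 a.2)).re
      + ∑ b : dec.Idx, N.crosstalk dec r a b * dec.p b.1 b.2)

/-- The diagonal matrix of SINRs normalized by the direct gains. -/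
noncomputable def sinrMatrix (N : InterferenceNetwork tx rx) {S : CovFamily tx}
    (dec : StreamDecomposition S) (r : ∀ l : Fin L, Fin (dec.M l) → Fin (rx l) → ℂ) :
    Matrix dec.Idx dec.Idx ℝ :=
  Matrix.diagonal fun a => N.sinr dec r a / N.gain dec r a a

/-- The noise powers of the streams in the reverse links. -/
noncomputable def reverseNoise (N : InterferenceNetwork tx rx) {S : CovFamily tx}
    (dec : StreamDecomposition S) : dec.Idx → ℝ := fun a =>
  (star (dec.t a.1 a.2) ⬝ᵥ Matrix.mulVec (N.What a.1) (dec.t a.1 a.2)).re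

/-- The reverse transmit powers `(D⁻¹ - Ψᵀ)⁻¹ n̂`. -/
noncomputable def reversePower (N : InterferenceNetwork tx rx) {S : CovFamily tx}
    (dec : StreamDecomposition S) (r : ∀ l : Fin L, Fin (dec.M l) → Fin (rx l) → ℂ) :
    dec.Idx → ℝ :=
  Matrix.mulVec ((N.sinrMatrix dec r)⁻¹ - (N.crosstalk dec r).transpose)⁻¹
    (N.reverseNoise dec)

/-- `Sh` is a covariance transformation of `S` computed from the stream decomposition `dec`. All
the steps have to be well defined: unit receive vectors exist and both inverses are genuine. -/
def IsCovTransformation (N : InterferenceNetwork tx rx) {S : CovFamily tx}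
    (dec : StreamDecomposition S) (Sh : CovFamily rx) : Prop :=
  ∃ r : ∀ l : Fin L, Fin (dec.M l) → Fin (rx l) → ℂ,
    N.IsReceiver dec r ∧
    IsUnit (N.sinrMatrix dec r).det ∧
    IsUnit ((N.sinrMatrix dec r)⁻¹ - (N.crosstalk dec r).transpose).det ∧
    ∀ l, Sh l = ∑ m : Fin (dec.M l),
      (N.reversePower dec r ⟨l, m⟩ : ℂ) • Matrix.vecMulVec (r l m) (star (r l m))

end InterferenceNetwork

/-! ### Multi-hop B-MAC amplify-and-forward relay networks -/

/-- A B-MAC AF relay network with `L` links and `Q ≥ 1` relay clusters, with the constraint matrices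
of its linear cost. The clusters are numbered `1, …, Q`; only the values of the `ℕ`-indexed families
at the indices that occur in the network are relevant. -/
structure RelayNetwork where
  L : ℕ
  Q : ℕ
  one_le_Q : 1 ≤ Q
  /-- numbers of antennas at the source and the destination of each link -/
  tx : Fin L → ℕ
  rx : Fin L → ℕ
  /-- total number of antennas of each relay cluster -/
  relay : ℕ → ℕ
  /-- channels from the sources to the first relay cluster -/
  H0 : ∀ l : Fin L, Matrix (Fin (relay 1)) (Fin (tx l)) ℂ
  /-- channel from cluster `q` to cluster `q + 1` -/
  H : ∀ q : ℕ, Matrix (Fin (relay (q + 1))) (Fin (relay q)) ℂ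
  /-- channels from the last relay cluster to the destinations -/
  HQ : ∀ l : Fin L, Matrix (Fin (rx l)) (Fin (relay Q)) ℂ
  /-- noise covariances at the relay clusters -/
  W : ∀ q : ℕ, Matrix (Fin (relay q)) (Fin (relay q)) ℂ
  /-- noise covariances at the destinations -/
  WD : CovFamily rx
  /-- constraint matrices at the relay clusters -/
  What : ∀ q : ℕ, Matrix (Fin (relay q)) (Fin (relay q)) ℂ
  /-- constraint matrices at the sources -/
  What0 : CovFamily tx
  /-- coupling matrix -/
  Φ : Matrix (Fin L) (Fin L) ℝ
  W_posSemidef : ∀ q, 1 ≤ q → q ≤ Q → (W q).PosSemidef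
  WD_posSemidef : ∀ l, (WD l).PosSemidef
  What_posDef : ∀ q, 1 ≤ q → q ≤ Q → (What q).PosDef
  What0_posSemidef : ∀ l, (What0 l).PosSemidef
  Φ_binary : ∀ l k, Φ l k = 0 ∨ Φ l k = 1
  Φ_diag : ∀ l, Φ l l = 0

namespace RelayNetwork

/-- Composite relay precoding matrices, one per cluster. Arbitrary square matrices are allowed;
block diagonal ones (one block per relay) are a special case. -/
abbrev Precoding (N : RelayNetwork) : Type :=
  ∀ q : ℕ, Matrix (Fin (N.relay q)) (Fin (N.relay q)) ℂ

/-- `B q q'` is the product `F q' * H (q'-1) * F (q'-1) * ⋯ * H q * F q` for `q ≤ q'`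
(and, by convention, zero otherwise). -/
noncomputable def B (N : RelayNetwork) (F : N.Precoding) (q q' : ℕ) :
    Matrix (Fin (N.relay q')) (Fin (N.relay q)) ℂ :=
  if h : q ≤ q' then
    Nat.leRec (motive := fun k _ => Matrix (Fin (N.relay k)) (Fin (N.relay q)) ℂ)
      (F q) (fun k _ X => F (k + 1) * N.H k * X) h
  else 0

/-- The equivalent channel from the source of link `k` to the destination of link `l`. -/
noncomputable def eqChannel (N : RelayNetwork) (F : N.Precoding) (l k : Fin N.L) :
    Matrix (Fin (N.rx l)) (Fin (N.tx k)) ℂ :=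
  N.HQ l * N.B F 1 N.Q * N.H0 k

/-- The equivalent noise covariance at the destination of link `l`. -/
noncomputable def eqNoise (N : RelayNetwork) (F : N.Precoding) : CovFamily N.rx := fun l =>
  ∑ q ∈ Finset.Icc 1 N.Q,
      N.HQ l * N.B F q N.Q * N.W q * (N.B F q N.Q).conjTranspose * (N.HQ l).conjTranspose
    + N.WD l

/-- The equivalent constraint matrix of link `l`. -/
noncomputable def eqConstraint (N : RelayNetwork) (F : N.Precoding) : CovFamily N.tx := fun l =>
  ∑ q ∈ Finset.Icc 1 N.Q,
      (N.H0 l).conjTranspose * (N.B F 1 q).conjTranspose * N.What q * N.B F 1 q * N.H0 l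
    + N.What0 l

/-- The covariance of the signal transmitted by relay cluster `q`. -/
noncomputable def relayCov (N : RelayNetwork) (F : N.Precoding) (S : CovFamily N.tx) (q : ℕ) :
    Matrix (Fin (N.relay q)) (Fin (N.relay q)) ℂ :=
  ∑ l, N.B F 1 q * N.H0 l * S l * (N.H0 l).conjTranspose * (N.B F 1 q).conjTranspose
    + ∑ q' ∈ Finset.Icc 1 q, N.B F q' q * N.W q' * (N.B F q' q).conjTranspose

/-- The interference-plus-noise covariance `Ω l` at the destination of link `l`. -/
noncomputable def Omega (N : RelayNetwork) (F : N.Precoding) (S : CovFamily N.tx) :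
    CovFamily N.rx := fun l =>
  N.eqNoise F l
    + ∑ k, N.Φ l k • (N.eqChannel F l k * S k * (N.eqChannel F l k).conjTranspose)

/-- The achievable rate of link `l` (the determinant is a positive real number for positive
semidefinite `S` and invertible `Ω l`). -/
noncomputable def rate (N : RelayNetwork) (F : N.Precoding) (S : CovFamily N.tx)
    (l : Fin N.L) : ℝ :=
  Real.log (1 + N.eqChannel F l l * S l * (N.eqChannel F l l).conjTranspose
    * (N.Omega F S l)⁻¹).det.re

/-- The Lagrangian with rate weights `w`. -/
noncomputable def lagrangian (N : RelayNetwork) (w : Fin N.L → ℝ) (F : N.Precoding)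
    (S : CovFamily N.tx) : ℝ :=
  ∑ l, w l * N.rate F S l
    - ∑ l, (S l * N.What0 l).trace.re
    - ∑ q ∈ Finset.Icc 1 N.Q, (N.relayCov F S q * N.What q).trace.re

end RelayNetwork

/-- `G` is the gradient of `f` with respect to the Hermitian matrix variable `S l`, for the real
inner product `Re Tr (G D)` on Hermitian matrices. -/
def IsPartialGradient {L : ℕ} {n : Fin L → ℕ} (f : CovFamily n → ℝ) (S : CovFamily n)
    (l : Fin L) (G : Matrix (Fin (n l)) (Fin (n l)) ℂ) : Prop :=
  G.IsHermitian ∧ ∀ D : Matrix (Fin (n l)) (Fin (n l)) ℂ, D.IsHermitian →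
    HasDerivAt (fun x : ℝ => f (Function.update S l (S l + x • D))) (G * D).trace.re 0

namespace RelayNetwork

/-- `S` is a stationary point, i.e. satisfies the KKT conditions, of the maximization of the
Lagrangian over positive semidefinite input covariances for fixed precoding matrices `F`. -/
def IsStationary (N : RelayNetwork) (w : Fin N.L → ℝ) (F : N.Precoding)
    (S : CovFamily N.tx) : Prop :=
  (∀ l, (S l).PosSemidef) ∧
  ∀ l, ∃ G : Matrix (Fin (N.tx l)) (Fin (N.tx l)) ℂ,
    IsPartialGradient (N.lagrangian w F) S l G ∧ (-G).PosSemidef ∧ (S l * G).trace = 0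

/-- The one-hop network that is equivalent to the relay network for fixed precoding `F`. -/
noncomputable def equivalent (N : RelayNetwork) (F : N.Precoding) :
    InterferenceNetwork N.tx N.rx where
  H := N.eqChannel F
  W := N.eqNoise F
  What := N.eqConstraint F
  Φ := N.Φ

/-- The dual precoding matrices. -/
def dualPrecoding (N : RelayNetwork) (F : N.Precoding) : N.Precoding :=
  fun q => (F q).conjTranspose

/-- `Sh, Fh` is a Type I dual transformation of `S, F`, computed from the decomposition `dec`
of `S` into streams. -/
def IsTypeIDual (N : RelayNetwork) (F : N.Precoding) {S : CovFamily N.tx}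
    (dec : StreamDecomposition S) (Sh : CovFamily N.rx) (Fh : N.Precoding) : Prop :=
  (N.equivalent F).IsCovTransformation dec Sh ∧ Fh = N.dualPrecoding F

/-- In the dual network with precoding `Fh`, the matrix
`B̂ q q' = (Fh q')† * H (q'-1) * (Fh (q'-1))† * ⋯ * H q * (Fh q)†`. -/
noncomputable def dualB (N : RelayNetwork) (Fh : N.Precoding) (q q' : ℕ) :
    Matrix (Fin (N.relay q')) (Fin (N.relay q)) ℂ :=
  N.B (fun i => (Fh i).conjTranspose) q q'

/-- In the dual network, the channel of the reverse link from the destination of link `k` to the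
source of link `l`. -/
noncomputable def dualChannel (N : RelayNetwork) (Fh : N.Precoding) (l k : Fin N.L) :
    Matrix (Fin (N.tx l)) (Fin (N.rx k)) ℂ :=
  (N.H0 l).conjTranspose * (N.dualB Fh 1 N.Q).conjTranspose * (N.HQ k).conjTranspose

/-- The interference-plus-noise covariance `Ω̂ l` at the source of link `l` in the dual network. -/
noncomputable def dualOmega (N : RelayNetwork) (Fh : N.Precoding) (Sh : CovFamily N.rx) :
    CovFamily N.tx := fun l =>
  N.What0 l
    + ∑ q ∈ Finset.Icc 1 N.Q,
        (N.H0 l).conjTranspose * (N.dualB Fh 1 q).conjTranspose * N.What q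
          * N.dualB Fh 1 q * N.H0 l
    + ∑ k, N.Φ k l • (N.dualChannel Fh l k * Sh k * (N.dualChannel Fh l k).conjTranspose)

/-- The family `w l • (Ω l⁻¹ - (Ω l + Ȟ l l * S l * (Ȟ l l)†)⁻¹)`. -/
noncomputable def explicitDual (N : RelayNetwork) (w : Fin N.L → ℝ) (F : N.Precoding)
    (S : CovFamily N.tx) : CovFamily N.rx := fun l =>
  w l • ((N.Omega F S l)⁻¹
    - (N.Omega F S l
        + N.eqChannel F l l * S l * (N.eqChannel F l l).conjTranspose)⁻¹)

/-- The whitened channel `Ω l ^ (-1/2) * Ȟ l l * Ω̂ l ^ (-1/2)`. -/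
noncomputable def whitenedChannel (N : RelayNetwork) (F : N.Precoding) (S : CovFamily N.tx)
    (Sh : CovFamily N.rx) (l : Fin N.L) : Matrix (Fin (N.rx l)) (Fin (N.tx l)) ℂ :=
  (CFC.sqrt (N.Omega F S l))⁻¹ * N.eqChannel F l l
    * (CFC.sqrt (N.dualOmega (N.dualPrecoding F) Sh l))⁻¹

end RelayNetwork

/-- `A = E Δ G†` is a thin singular value decomposition: `E` and `G` have orthonormal columns, and
`Δ` is diagonal with the positive entries `δ`. -/
structure IsThinSVD {m n N : ℕ} (A : Matrix (Fin m) (Fin n) ℂ) (E : Matrix (Fin m) (Fin N) ℂ)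
    (δ : Fin N → ℝ) (G : Matrix (Fin n) (Fin N) ℂ) : Prop where
  left_orthonormal : E.conjTranspose * E = 1
  right_orthonormal : G.conjTranspose * G = 1
  pos : ∀ i, 0 < δ i
  eq : A = E * Matrix.diagonal (fun i => (δ i : ℂ)) * G.conjTranspose

/-- `U (w I - Δ⁻²)⁺ U†`, where `Δ` is diagonal with entries `δ`. -/
noncomputable def waterFilling {n N : ℕ} (w : ℝ) (δ : Fin N → ℝ)
    (U : Matrix (Fin n) (Fin N) ℂ) : Matrix (Fin n) (Fin n) ℂ :=
  U * Matrix.diagonal (fun i => ((max (w - (δ i ^ 2)⁻¹) 0 : ℝ) : ℂ)) * U.conjTranspose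

namespace RelayNetwork

/-- A thin singular value decomposition of the whitened channel of link `l`, of size the rank of
the equivalent channel of link `l`. -/
def IsWhitenedSVD (N : RelayNetwork) (F : N.Precoding) (S : CovFamily N.tx)
    (Sh : CovFamily N.rx) (l : Fin N.L)
    (E : Matrix (Fin (N.rx l)) (Fin (N.eqChannel F l l).rank) ℂ)
    (δ : Fin (N.eqChannel F l l).rank → ℝ)
    (G : Matrix (Fin (N.tx l)) (Fin (N.eqChannel F l l).rank) ℂ) : Prop :=
  IsThinSVD (N.whitenedChannel F S Sh l) E δ G

/-- The whitened input covariance `Ω̂ l ^ (1/2) * S l * Ω̂ l ^ (1/2)`. -/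
noncomputable def whitenedInput (N : RelayNetwork) (F : N.Precoding) (S : CovFamily N.tx)
    (Sh : CovFamily N.rx) (l : Fin N.L) : Matrix (Fin (N.tx l)) (Fin (N.tx l)) ℂ :=
  CFC.sqrt (N.dualOmega (N.dualPrecoding F) Sh l) * S l
    * CFC.sqrt (N.dualOmega (N.dualPrecoding F) Sh l)

/-- The whitened dual input covariance `Ω l ^ (1/2) * Sh l * Ω l ^ (1/2)`. -/
noncomputable def whitenedDualInput (N : RelayNetwork) (F : N.Precoding) (S : CovFamily N.tx)
    (Sh : CovFamily N.rx) (l : Fin N.L) : Matrix (Fin (N.rx l)) (Fin (N.rx l)) ℂ :=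
  CFC.sqrt (N.Omega F S l) * Sh l * CFC.sqrt (N.Omega F S l)

/-- `S` has the polite water-filling structure (with the dual covariances `Sh`), for some thin
singular value decomposition of each whitened channel. -/
def HasPWF (N : RelayNetwork) (w : Fin N.L → ℝ) (F : N.Precoding) (S : CovFamily N.tx)
    (Sh : CovFamily N.rx) : Prop :=
  ∀ l, ∃ E δ G, N.IsWhitenedSVD F S Sh l E δ G ∧
    N.whitenedInput F S Sh l = waterFilling (w l) δ G

/-- The dual covariances `Sh` have the polite water-filling structure (with `S`), for some thin
singular value decomposition of each whitened channel. -/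
def HasDualPWF (N : RelayNetwork) (w : Fin N.L → ℝ) (F : N.Precoding) (S : CovFamily N.tx)
    (Sh : CovFamily N.rx) : Prop :=
  ∀ l, ∃ E δ G, N.IsWhitenedSVD F S Sh l E δ G ∧
    N.whitenedDualInput F S Sh l = waterFilling (w l) δ E

end RelayNetwork

/-! For fixed precoding the relay network is a one-hop interference network with coloured noise, and
the claim reduces to one KKT system per link. Write `X k` for the total received covariance `Ω k + Ȟ
k k * S k * (Ȟ k k)†`. Raising the input of link `l` costs the constraint term and lowers the rates
of the other links; the loss of link `k` is the form of `w k • (Ω k⁻¹ - X k⁻¹)` pulled back along `Ȟ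
k l`. These matrices are exactly `explicitDual`, so cost and losses add up to the dual interference
covariance that this family generates. Hence stationarity means that each `S l` satisfies the KKT
conditions of `w log |Ω + H S H†| - Tr (S Ω̂)` with `Ω̂` computed from `explicitDual`
(`isPartialGradient_lagrangian`, `isStationary_iff`).

Whitening by the square roots reduces such a system to `Ω = Ω̂ = 1`, where water filling over a thin
SVD is a solution (`IsThinSVD.isKKT_waterFilling`). Solutions are unique (`IsKKT.unique`), so (P) is
equivalent to the KKT system for every choice of the SVD. The water-filling spectrum is also that of
`w (1 - (1 + A T A†)⁻¹)` on the left singular vectors, which makes (D) equivalent to the explicit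
formula once the KKT system holds.

The Type I dual is handled stream by stream. Removing one stream changes the inverse covariance by a
multiple of `r r†` for the MMSE receiver `r` (`mmse_receiver`), and these changes telescope to the
explicit formula. Complementary slackness along the streams turns the global system for the reverse
powers into a triangular recursion within each link, solved only by the telescoping coefficients.
The system itself is nonsingular with nonnegative solution because its transpose has nonpositive
off-diagonal entries and maps the forward powers to the positive noise powers.

For the converse, (P) gives the KKT system with the `Ω̂` of the given dual family. Each of the three
hypotheses on that family identifies it with `explicitDual`, and stationarity follows. -/

open Matrix

/-! ### Traces and inverses of positive semidefinite matrices. -/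

namespace Matrix

variable {m n : Type*} [Fintype m] [Fintype n] [DecidableEq m] [DecidableEq n]

theorem PosSemidef.sqrt_mul_sqrt {A : Matrix n n ℂ} (hA : A.PosSemidef) :
    CFC.sqrt A * CFC.sqrt A = A :=
  CFC.sqrt_mul_sqrt_self A hA.nonneg

theorem isHermitian_sqrt (A : Matrix n n ℂ) : (CFC.sqrt A).IsHermitian :=
  (nonneg_iff_posSemidef.1 (CFC.sqrt_nonneg A)).isHermitian

theorem PosDef.isUnit_det {A : Matrix n n ℂ} (hA : A.PosDef) : IsUnit A.det :=
  (isUnit_iff_isUnit_det A).1 hA.isUnit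

theorem PosDef.isUnit_det_sqrt {A : Matrix n n ℂ} (hA : A.PosDef) : IsUnit (CFC.sqrt A).det := by
  have h := hA.isUnit_det
  rw [← hA.posSemidef.sqrt_mul_sqrt, det_mul] at h
  exact isUnit_of_mul_isUnit_left h

theorem PosSemidef.trace_mul_nonneg {A B : Matrix n n ℂ} (hA : A.PosSemidef)
    (hB : B.PosSemidef) : 0 ≤ (A * B).trace := by
  rw [← hB.sqrt_mul_sqrt, ← Matrix.mul_assoc, trace_mul_comm]
  have := (hA.mul_mul_conjTranspose_same (CFC.sqrt B)).trace_nonneg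
  rwa [(isHermitian_sqrt B).eq, Matrix.mul_assoc] at this

/-- The trace is the squared Frobenius norm of `√A √B`. It upgrades complementary slackness from a
trace identity to a matrix identity. -/
theorem PosSemidef.mul_eq_zero_of_trace {A B : Matrix n n ℂ} (hA : A.PosSemidef)
    (hB : B.PosSemidef) (h : (A * B).trace = 0) : A * B = 0 := by
  have h1 : ((CFC.sqrt A * CFC.sqrt B)ᴴ * (CFC.sqrt A * CFC.sqrt B)).trace = 0 := by
    rw [conjTranspose_mul, (isHermitian_sqrt A).eq, (isHermitian_sqrt B).eq, ← h]
    conv_rhs => rw [← hA.sqrt_mul_sqrt, ← hB.sqrt_mul_sqrt]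
    rw [← Matrix.mul_assoc (CFC.sqrt A * CFC.sqrt A), trace_mul_comm _ (CFC.sqrt B)]
    simp only [Matrix.mul_assoc]
  have h2 := trace_conjTranspose_mul_self_eq_zero_iff.1 h1
  calc A * B = CFC.sqrt A * (CFC.sqrt A * CFC.sqrt B) * CFC.sqrt B := by
        conv_lhs => rw [← hA.sqrt_mul_sqrt, ← hB.sqrt_mul_sqrt]
        simp only [Matrix.mul_assoc]
    _ = 0 := by rw [h2]; simp

/-- Monotonicity of the inverse, for a positive definite matrix and a semidefinite perturbation. -/
theorem PosDef.posSemidef_inv_sub_inv_add {A P : Matrix n n ℂ} (hA : A.PosDef)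
    (hP : P.PosSemidef) : (A⁻¹ - (A + P)⁻¹).PosSemidef := by
  have hX := hA.add_posSemidef hP
  have hu := hX.isUnit_det
  have hv := hA.isUnit_det
  -- With `X = A + P`, this is `X A⁻¹ X - X = P + P A⁻¹ P` conjugated by `X⁻¹`; no square root of
  -- `A` is needed.
  have e : A⁻¹ - (A + P)⁻¹ = (A + P)⁻¹ * (P + P * A⁻¹ * P) * (A + P)⁻¹ := by
    have h1 : P + P * A⁻¹ * P = (A + P) * A⁻¹ * (A + P) - (A + P) := by
      rw [Matrix.add_mul, Matrix.mul_nonsing_inv _ hv, Matrix.add_mul, Matrix.one_mul,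
        Matrix.mul_add, Matrix.mul_assoc P A⁻¹ A, Matrix.nonsing_inv_mul _ hv]
      simp only [Matrix.mul_one]
      abel
    rw [h1, Matrix.mul_sub, Matrix.sub_mul, Matrix.nonsing_inv_mul _ hu, Matrix.one_mul,
      ← Matrix.mul_assoc, ← Matrix.mul_assoc, Matrix.nonsing_inv_mul _ hu, Matrix.one_mul,
      Matrix.mul_assoc, Matrix.mul_nonsing_inv _ hu, Matrix.mul_one]
  rw [e]
  have h2 : (P + P * A⁻¹ * P).PosSemidef := by
    refine hP.add ?_
    have := hA.inv.posSemidef.mul_mul_conjTranspose_same P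
    rwa [hP.isHermitian.eq] at this
  have := h2.mul_mul_conjTranspose_same (A + P)⁻¹
  rwa [hX.inv.isHermitian.eq] at this

omit [Fintype m] [DecidableEq m] [DecidableEq n] in
theorem smul_mul_mulVec_vecMulVec_star (c : ℂ) (B : Matrix m n ℂ) (t : n → ℂ) :
    B * (c • vecMulVec t (star t)) * Bᴴ = c • vecMulVec (B *ᵥ t) (star (B *ᵥ t)) := by
  rw [Matrix.mul_smul, Matrix.smul_mul, mul_vecMulVec, vecMulVec_mul, star_mulVec]

/-- The Sherman-Morrison formula for a positive definite matrix. -/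
theorem PosDef.inv_sub_inv_add_vecMulVec {A : Matrix n n ℂ} (hA : A.PosDef) {p : ℝ} (hp : 0 < p)
    (h : n → ℂ) :
    A⁻¹ - (A + (p : ℂ) • vecMulVec h (star h))⁻¹ =
      ((p : ℂ) / (1 + p * (star h ⬝ᵥ A⁻¹ *ᵥ h))) •
        vecMulVec (A⁻¹ *ᵥ h) (star (A⁻¹ *ᵥ h)) := by
  set g := star h ⬝ᵥ A⁻¹ *ᵥ h with hg
  have hg0 : 0 ≤ g := hA.inv.posSemidef.dotProduct_mulVec_nonneg h
  have hne : (1 + p * g : ℂ) ≠ 0 := by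
    have : (0 : ℂ) ≤ p := by exact_mod_cast hp.le
    have h1 : (0 : ℂ) < 1 + p * g := by positivity
    exact h1.ne'
  have hv := hA.isUnit_det
  have hs : star (A⁻¹ *ᵥ h) = star h ᵥ* A⁻¹ := by rw [star_mulVec, hA.inv.isHermitian.eq]
  have key : (A + (p : ℂ) • vecMulVec h (star h))⁻¹ =
      A⁻¹ - ((p : ℂ) / (1 + p * g)) • vecMulVec (A⁻¹ *ᵥ h) (star (A⁻¹ *ᵥ h)) := by
    apply inv_eq_right_inv
    rw [Matrix.mul_sub, Matrix.add_mul, Matrix.mul_nonsing_inv _ hv, Matrix.smul_mul,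
      vecMulVec_mul, Matrix.mul_smul, Matrix.add_mul, mul_vecMulVec, mulVec_mulVec,
      Matrix.mul_nonsing_inv _ hv, one_mulVec, Matrix.smul_mul, vecMulVec_mul_vecMulVec, ← hg, hs,
      smul_add]
    have : vecMulVec h (g • star h ᵥ* A⁻¹) = g • vecMulVec h (star h ᵥ* A⁻¹) := by
      ext i j; simp [vecMulVec_apply]; ring
    rw [this, smul_smul, smul_smul, add_sub_assoc, ← add_smul, ← sub_smul]
    have : (p : ℂ) - (p / (1 + p * g) + p / (1 + p * g) * p * g) = 0 := by
      field_simp; ring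
    rw [this, zero_smul, add_zero]
  rw [key, sub_sub_cancel]

end Matrix

/-! ### The single-link KKT system: uniqueness and whitening. -/

namespace Matrix

/-- The Karush-Kuhn-Tucker conditions of the maximization of
`w log |Om + H S H†| - Tr (S Oh)` over positive semidefinite `S`. -/
structure IsKKT {m n : Type*} [Fintype m] [Fintype n] [DecidableEq m] (w : ℝ)
    (H : Matrix m n ℂ) (Om : Matrix m m ℂ) (Oh S : Matrix n n ℂ) : Prop where
  posSemidef : (Oh - w • (Hᴴ * (Om + H * S * Hᴴ)⁻¹ * H)).PosSemidef
  mul_eq_zero : S * (Oh - w • (Hᴴ * (Om + H * S * Hᴴ)⁻¹ * H)) = 0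

variable {m n : Type*} [Fintype m] [Fintype n] [DecidableEq m] [DecidableEq n]

/-- Complementary slackness and invertibility of `Oh` express `S` through `S` times `w Hᴴ X⁻¹ H`;
inserting this into its own adjoint leaves `S` only inside `H S Hᴴ`. A solution is therefore
determined by its received covariance, even when `H` is not injective. -/
theorem IsKKT.eq_sandwich {w : ℝ} {H : Matrix m n ℂ} {Om : Matrix m m ℂ} {Oh S : Matrix n n ℂ}
    (hOm : Om.PosDef) (hOh : Oh.PosDef) (hS : S.PosSemidef) (h : IsKKT w H Om Oh S) :
    S = Oh⁻¹ * (w • (Hᴴ * (Om + H * S * Hᴴ)⁻¹)) * (H * S * Hᴴ) *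
      (w • ((Om + H * S * Hᴴ)⁻¹ * H)) * Oh⁻¹ := by
  have hX : (Om + H * S * Hᴴ).PosDef := hOm.add_posSemidef (hS.mul_mul_conjTranspose_same H)
  set X := Om + H * S * Hᴴ
  have hu := hOh.isUnit_det
  have h1 : S = S * (w • (Hᴴ * X⁻¹ * H)) * Oh⁻¹ := by
    have := h.mul_eq_zero
    rw [Matrix.mul_sub, sub_eq_zero] at this
    rw [← this, Matrix.mul_assoc, Matrix.mul_nonsing_inv _ hu, Matrix.mul_one]
  have h2 : S = Oh⁻¹ * (w • (Hᴴ * X⁻¹ * H)) * S := by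
    have := congrArg conjTranspose h1
    simp only [conjTranspose_mul, conjTranspose_smul, conjTranspose_conjTranspose,
      hS.isHermitian.eq, hOh.inv.isHermitian.eq, hX.inv.isHermitian.eq, star_trivial] at this
    simpa only [Matrix.mul_assoc] using this
  calc S = Oh⁻¹ * (w • (Hᴴ * X⁻¹ * H)) * (S * (w • (Hᴴ * X⁻¹ * H)) * Oh⁻¹) := by
        rw [← h1]; exact h2
    _ = _ := by
        simp only [Matrix.mul_assoc, Matrix.smul_mul, Matrix.mul_smul]

/-- Strict monotonicity: pairing `S₁ - S₂` with the difference of the two slack matrices gives a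
trace that is nonpositive by complementary slackness, and nonnegative because matrix inversion is
order reversing. It must vanish, which forces equal received covariances. -/
theorem IsKKT.unique {w : ℝ} (hw : 0 ≤ w) {H : Matrix m n ℂ} {Om : Matrix m m ℂ}
    {Oh S₁ S₂ : Matrix n n ℂ} (hOm : Om.PosDef) (hOh : Oh.PosDef) (hS₁ : S₁.PosSemidef)
    (hS₂ : S₂.PosSemidef) (h₁ : IsKKT w H Om Oh S₁) (h₂ : IsKKT w H Om Oh S₂) : S₁ = S₂ := by
  -- For zero weight the sandwich formula gives `S = 0` at once; the trace argument below divides by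
  -- `w`.
  rcases hw.eq_or_lt with rfl | hw
  · rw [h₁.eq_sandwich hOm hOh hS₁, h₂.eq_sandwich hOm hOh hS₂]
    simp
  suffices hD : H * S₁ * Hᴴ = H * S₂ * Hᴴ by
    rw [h₁.eq_sandwich hOm hOh hS₁, h₂.eq_sandwich hOm hOh hS₂, hD]
  have hA₁ : (Om + H * S₁ * Hᴴ).PosDef := hOm.add_posSemidef (hS₁.mul_mul_conjTranspose_same H)
  have hA₂ : (Om + H * S₂ * Hᴴ).PosDef := hOm.add_posSemidef (hS₂.mul_mul_conjTranspose_same H)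
  obtain ⟨p₁, z₁⟩ := h₁
  obtain ⟨p₂, z₂⟩ := h₂
  have hDe : H * (S₁ - S₂) * Hᴴ = (Om + H * S₁ * Hᴴ) - (Om + H * S₂ * Hᴴ) := by
    rw [Matrix.mul_sub, Matrix.sub_mul]; abel
  set A₁ := Om + H * S₁ * Hᴴ with hA₁e
  set A₂ := Om + H * S₂ * Hᴴ with hA₂e
  have hinv : A₂⁻¹ - A₁⁻¹ = A₂⁻¹ * (A₁ - A₂) * A₁⁻¹ := by
    rw [Matrix.mul_sub, Matrix.nonsing_inv_mul _ hA₂.isUnit_det, Matrix.sub_mul, Matrix.mul_assoc,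
      Matrix.mul_nonsing_inv _ hA₁.isUnit_det, Matrix.mul_one, Matrix.one_mul]
  have hDH : (A₁ - A₂).IsHermitian := hA₁.isHermitian.sub hA₂.isHermitian
  have hP : ((A₁ - A₂) * A₂⁻¹ * (A₁ - A₂)).PosSemidef := by
    have := hA₂.inv.posSemidef.mul_mul_conjTranspose_same (A₁ - A₂)
    rwa [hDH.eq] at this
  have ht := hP.trace_mul_nonneg hA₁.inv.posSemidef
  have htr : ((S₁ - S₂) * ((Oh - w • (Hᴴ * A₁⁻¹ * H)) - (Oh - w • (Hᴴ * A₂⁻¹ * H)))).trace =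
      w • ((A₁ - A₂) * A₂⁻¹ * (A₁ - A₂) * A₁⁻¹).trace := by
    have : (Oh - w • (Hᴴ * A₁⁻¹ * H)) - (Oh - w • (Hᴴ * A₂⁻¹ * H)) =
        w • (Hᴴ * (A₂⁻¹ - A₁⁻¹) * H) := by
      rw [Matrix.mul_sub, Matrix.sub_mul, smul_sub]; abel
    rw [this, Matrix.mul_smul, trace_smul, ← Matrix.mul_assoc, trace_mul_comm,
      ← Matrix.mul_assoc, ← Matrix.mul_assoc, hDe, hinv]
    simp only [Matrix.mul_assoc]
  have htr' : ((S₁ - S₂) * ((Oh - w • (Hᴴ * A₁⁻¹ * H)) - (Oh - w • (Hᴴ * A₂⁻¹ * H)))).trace ≤ 0 := by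
    rw [Matrix.sub_mul, Matrix.mul_sub S₁ (Oh - w • (Hᴴ * A₁⁻¹ * H)),
      Matrix.mul_sub S₂ (Oh - w • (Hᴴ * A₁⁻¹ * H)), z₁, z₂, zero_sub, sub_zero, trace_sub,
      trace_neg]
    have a := hS₁.trace_mul_nonneg p₂
    have b := hS₂.trace_mul_nonneg p₁
    have := add_nonneg a b
    rw [← neg_nonneg]
    convert this using 1
    ring
  rw [htr] at htr'
  have h0 : ((A₁ - A₂) * A₂⁻¹ * (A₁ - A₂) * A₁⁻¹).trace = 0 := by
    have h3 : w • ((A₁ - A₂) * A₂⁻¹ * (A₁ - A₂) * A₁⁻¹).trace = 0 :=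
      le_antisymm htr' (smul_nonneg hw.le ht)
    exact (smul_eq_zero.1 h3).resolve_left hw.ne'
  have h1 := hP.mul_eq_zero_of_trace hA₁.inv.posSemidef h0
  -- The two positive definite inverses are stripped off one after the other, leaving the squared
  -- Frobenius norm of `A₁ - A₂`.
  have h2 : (A₁ - A₂) * A₂⁻¹ * (A₁ - A₂) = 0 := by
    rw [← Matrix.mul_one ((A₁ - A₂) * A₂⁻¹ * (A₁ - A₂)),
      ← Matrix.nonsing_inv_mul _ hA₁.isUnit_det, ← Matrix.mul_assoc, h1, Matrix.zero_mul]
  have h3 : (A₁ - A₂) * (A₁ - A₂)ᴴ * A₂⁻¹ = 0 := by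
    refine (posSemidef_self_mul_conjTranspose _).mul_eq_zero_of_trace hA₂.inv.posSemidef ?_
    rw [hDH.eq, Matrix.mul_assoc, trace_mul_comm, h2, trace_zero]
  have h4 : (A₁ - A₂) * (A₁ - A₂)ᴴ = 0 := by
    rw [← Matrix.mul_one ((A₁ - A₂) * (A₁ - A₂)ᴴ),
      ← Matrix.nonsing_inv_mul _ hA₂.isUnit_det, ← Matrix.mul_assoc, h3, Matrix.zero_mul]
  have h5 := sub_eq_zero.1 (self_mul_conjTranspose_eq_zero.1 h4)
  rw [hA₁e, hA₂e] at h5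
  exact add_left_cancel h5

/-- In the application `R` and `Rh` are the square roots of the noise covariance and of the
constraint matrix. -/
theorem whitened_add {R : Matrix m m ℂ} {Rh S : Matrix n n ℂ} (H : Matrix m n ℂ)
    (hR : R.IsHermitian) (hRh : Rh.IsHermitian) (uR : IsUnit R.det) (uRh : IsUnit Rh.det) :
    1 + R⁻¹ * H * Rh⁻¹ * (Rh * S * Rh) * (R⁻¹ * H * Rh⁻¹)ᴴ =
      R⁻¹ * (R * R + H * S * Hᴴ) * R⁻¹ := by
  simp only [conjTranspose_mul, hR.inv.eq, hRh.inv.eq]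
  rw [Matrix.mul_add, Matrix.add_mul, ← Matrix.mul_assoc R⁻¹ R R, Matrix.nonsing_inv_mul _ uR,
    Matrix.one_mul, Matrix.mul_nonsing_inv _ uR]
  congr 1
  calc R⁻¹ * H * Rh⁻¹ * (Rh * S * Rh) * (Rh⁻¹ * (Hᴴ * R⁻¹))
      = R⁻¹ * H * (Rh⁻¹ * Rh) * S * (Rh * Rh⁻¹) * (Hᴴ * R⁻¹) := by simp only [Matrix.mul_assoc]
    _ = _ := by
      rw [Matrix.nonsing_inv_mul _ uRh, Matrix.mul_nonsing_inv _ uRh]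
      simp only [Matrix.mul_assoc, Matrix.mul_one]

theorem whitened_add_inv {R : Matrix m m ℂ} {Rh S : Matrix n n ℂ} (H : Matrix m n ℂ)
    (hR : R.IsHermitian) (hRh : Rh.IsHermitian) (uR : IsUnit R.det) (uRh : IsUnit Rh.det) :
    (1 + R⁻¹ * H * Rh⁻¹ * (Rh * S * Rh) * (R⁻¹ * H * Rh⁻¹)ᴴ)⁻¹ =
      R * (R * R + H * S * Hᴴ)⁻¹ * R := by
  rw [whitened_add H hR hRh uR uRh, Matrix.mul_inv_rev, Matrix.mul_inv_rev,
    Matrix.nonsing_inv_nonsing_inv _ uR, ← Matrix.mul_assoc]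

/-- The slack matrix of the whitened problem is the original one conjugated by the Hermitian
invertible `Rh⁻¹`. Congruence preserves semidefiniteness, and the factors `Rh` cancel in the
slackness product. -/
theorem isKKT_whitened_iff {w : ℝ} {R : Matrix m m ℂ} {Rh S : Matrix n n ℂ} {H : Matrix m n ℂ}
    (hR : R.IsHermitian) (hRh : Rh.IsHermitian) (uR : IsUnit R.det) (uRh : IsUnit Rh.det) :
    IsKKT w (R⁻¹ * H * Rh⁻¹) 1 1 (Rh * S * Rh) ↔ IsKKT w H (R * R) (Rh * Rh) S := by
  have hM : 1 - w • ((R⁻¹ * H * Rh⁻¹)ᴴ *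
      (1 + R⁻¹ * H * Rh⁻¹ * (Rh * S * Rh) * (R⁻¹ * H * Rh⁻¹)ᴴ)⁻¹ * (R⁻¹ * H * Rh⁻¹)) =
      Rh⁻¹ * (Rh * Rh - w • (Hᴴ * (R * R + H * S * Hᴴ)⁻¹ * H)) * Rh⁻¹ := by
    rw [whitened_add_inv H hR hRh uR uRh, Matrix.mul_sub, Matrix.sub_mul,
      ← Matrix.mul_assoc Rh⁻¹ Rh Rh, Matrix.nonsing_inv_mul _ uRh,
      Matrix.one_mul, Matrix.mul_nonsing_inv _ uRh, Matrix.mul_smul, Matrix.smul_mul]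
    simp only [conjTranspose_mul, hR.inv.eq, hRh.inv.eq]
    congr 2
    calc Rh⁻¹ * (Hᴴ * R⁻¹) * (R * (R * R + H * S * Hᴴ)⁻¹ * R) * (R⁻¹ * H * Rh⁻¹)
        = Rh⁻¹ * Hᴴ * (R⁻¹ * R) * (R * R + H * S * Hᴴ)⁻¹ * (R * R⁻¹) * H * Rh⁻¹ := by
          simp only [Matrix.mul_assoc]
      _ = _ := by
        rw [Matrix.nonsing_inv_mul _ uR, Matrix.mul_nonsing_inv _ uR]
        simp only [Matrix.mul_assoc, Matrix.mul_one]
  have hRhu : IsUnit Rh⁻¹ := by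
    rw [isUnit_iff_isUnit_det]; exact Matrix.isUnit_nonsing_inv_det _ uRh
  have hRhu' : IsUnit Rh := by rwa [isUnit_iff_isUnit_det]
  constructor
  · rintro ⟨a, b⟩
    rw [hM] at a b
    refine ⟨?_, ?_⟩
    · rw [← Matrix.IsUnit.posSemidef_star_right_conjugate_iff hRhu, star_eq_conjTranspose, hRh.inv.eq]
      exact a
    · have : Rh⁻¹ * (Rh * S * Rh * (Rh⁻¹ * (Rh * Rh - w • (Hᴴ * (R * R + H * S * Hᴴ)⁻¹ * H)) *
          Rh⁻¹)) * Rh = 0 := by rw [b]; simp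
      rw [← this]
      generalize Rh * Rh - w • (Hᴴ * (R * R + H * S * Hᴴ)⁻¹ * H) = M
      calc S * M = (Rh⁻¹ * Rh) * S * (Rh * Rh⁻¹) * M * (Rh⁻¹ * Rh) := by
            rw [Matrix.nonsing_inv_mul _ uRh, Matrix.mul_nonsing_inv _ uRh]; simp
        _ = _ := by simp only [Matrix.mul_assoc]
  · rintro ⟨a, b⟩
    rw [← Matrix.IsUnit.posSemidef_star_right_conjugate_iff hRhu, star_eq_conjTranspose, hRh.inv.eq] at a
    refine ⟨?_, ?_⟩ <;> rw [hM]
    · exact a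
    · revert b
      generalize Rh * Rh - w • (Hᴴ * (R * R + H * S * Hᴴ)⁻¹ * H) = M
      intro b
      calc Rh * S * Rh * (Rh⁻¹ * M * Rh⁻¹) = Rh * S * (Rh * Rh⁻¹) * M * Rh⁻¹ := by
            simp only [Matrix.mul_assoc]
        _ = Rh * (S * M) * Rh⁻¹ := by
            rw [Matrix.mul_nonsing_inv _ uRh]; simp only [Matrix.mul_assoc, Matrix.one_mul]
        _ = 0 := by rw [b]; simp

end Matrix

/-! ### Existence of thin singular value decompositions. -/

namespace Matrix

/-- A positive semidefinite matrix is diagonalized by orthonormal eigenvectors to the positive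
eigenvalues. -/
theorem PosSemidef.exists_thin_diagonalization {n N : ℕ} {T : Matrix (Fin n) (Fin n) ℂ}
    (hT : T.PosSemidef) (hN : T.rank = N) :
    ∃ (d : Fin N → ℝ) (G : Matrix (Fin n) (Fin N) ℂ), (∀ i, 0 < d i) ∧ Gᴴ * G = 1 ∧
      T = G * diagonal (fun i => (d i : ℂ)) * Gᴴ := by
  have hH := hT.isHermitian
  have hcard : Fintype.card {i // hH.eigenvalues i ≠ 0} = N := by
    rw [← hN, hH.rank_eq_card_non_zero_eigs]
  let e : Fin N ≃ {i // hH.eigenvalues i ≠ 0} := (Fintype.equivFinOfCardEq hcard).symm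
  set U : Matrix (Fin n) (Fin n) ℂ := hH.eigenvectorUnitary.1 with hU
  have hUU : Uᴴ * U = 1 := Unitary.coe_star_mul_self hH.eigenvectorUnitary
  refine ⟨fun i => hH.eigenvalues (e i), U.submatrix id (fun i => (e i : Fin n)), fun i => ?_,
    ?_, ?_⟩
  · exact lt_of_le_of_ne (hT.eigenvalues_nonneg _) (e i).2.symm
  · rw [conjTranspose_submatrix]
    ext i j
    have := congrFun (congrFun hUU (e i)) (e j)
    rw [mul_apply] at this
    simp only [mul_apply, submatrix_apply, id_eq]
    rw [this, one_apply, one_apply]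
    exact if_congr (by rw [← Subtype.ext_iff, e.injective.eq_iff]) rfl rfl
  · have hs : T = U * diagonal (fun i => (hH.eigenvalues i : ℂ)) * Uᴴ := hH.spectral_theorem
    conv_lhs => rw [hs]
    ext a b
    rw [mul_apply, mul_apply]
    simp only [mul_diagonal, conjTranspose_apply, submatrix_apply, id_eq]
    set f : Fin n → ℂ := fun i => U a i * (hH.eigenvalues i : ℂ) * star (U b i) with hf
    have h1 : ∑ i ∈ Finset.univ.filter (fun i => hH.eigenvalues i ≠ 0), f i = ∑ i, f i := by
      refine Finset.sum_filter_of_ne fun i _ hi h0 => hi ?_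
      simp [hf, h0]
    have h2 := Finset.sum_subtype (p := fun i => hH.eigenvalues i ≠ 0) (F := inferInstance)
      (Finset.univ.filter (fun i => hH.eigenvalues i ≠ 0)) (fun i => by simp) f
    exact h1.symm.trans (h2.trans (Equiv.sum_comp e fun i => f i).symm)

variable {m n N : ℕ}

/-- The right singular vectors and squared singular values come from diagonalizing `Aᴴ * A`, which
has the same rank as `A`; the left vectors are the normalized images of the right ones. -/
theorem exists_isThinSVD {A : Matrix (Fin m) (Fin n) ℂ} (hN : A.rank = N) :
    ∃ E δ G, IsThinSVD (N := N) A E δ G := by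
  obtain ⟨d, G, hd, hG, hT⟩ := (posSemidef_conjTranspose_mul_self A).exists_thin_diagonalization
    ((rank_conjTranspose_mul_self A).trans hN)
  -- `G * Gᴴ` projects onto the range of `Aᴴ * A`, whose orthogonal complement is the kernel of `A`.
  have hAG : A * (G * Gᴴ) = A := by
    have h1 : (A - A * (G * Gᴴ))ᴴ * (A - A * (G * Gᴴ)) = 0 := by
      have h2 : Aᴴ * (A - A * (G * Gᴴ)) = 0 := by
        rw [Matrix.mul_sub, ← Matrix.mul_assoc, hT, sub_eq_zero]
        calc G * diagonal (fun i => (d i : ℂ)) * Gᴴ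
            = G * diagonal (fun i => (d i : ℂ)) * (Gᴴ * G) * Gᴴ := by rw [hG, Matrix.mul_one]
          _ = _ := by simp only [Matrix.mul_assoc]
      rw [conjTranspose_sub, conjTranspose_mul, Matrix.sub_mul, Matrix.mul_assoc, h2]
      simp
    have := conjTranspose_mul_self_eq_zero.1 h1
    exact (sub_eq_zero.1 this).symm
  refine ⟨A * G * diagonal (fun i => (((√(d i))⁻¹ : ℝ) : ℂ)), fun i => √(d i), G, ?_, hG,
    fun i => Real.sqrt_pos.2 (hd i), ?_⟩
  · have : (diagonal (fun i => (((√(d i))⁻¹ : ℝ) : ℂ)))ᴴ =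
        diagonal (fun i => (((√(d i))⁻¹ : ℝ) : ℂ)) := by
      rw [diagonal_conjTranspose]; congr 1; ext i; simp
    rw [conjTranspose_mul, conjTranspose_mul, this]
    set D := diagonal (fun i => (((√(d i))⁻¹ : ℝ) : ℂ)) with hD
    calc D * (Gᴴ * Aᴴ) * (A * G * D) = D * (Gᴴ * (Aᴴ * A) * G) * D := by
          simp only [Matrix.mul_assoc]
      _ = D * ((Gᴴ * G) * diagonal (fun i => (d i : ℂ)) * (Gᴴ * G)) * D := by
          rw [hT]; simp only [Matrix.mul_assoc]
      _ = 1 := by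
          rw [hG, Matrix.one_mul, Matrix.mul_one, hD, diagonal_mul_diagonal,
            diagonal_mul_diagonal, ← diagonal_one]
          congr 1
          ext i
          have h0 : √(d i) ≠ 0 := (Real.sqrt_pos.2 (hd i)).ne'
          norm_cast
          have := Real.mul_self_sqrt (hd i).le
          field_simp
          nlinarith
  · rw [Matrix.mul_assoc (A * G), diagonal_mul_diagonal]
    have : (fun i => (((√(d i))⁻¹ : ℝ) : ℂ) * ((√(d i) : ℝ) : ℂ)) = fun _ => 1 := by
      ext i
      have h0 : √(d i) ≠ 0 := (Real.sqrt_pos.2 (hd i)).ne'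
      norm_cast
      field_simp
    rw [this, diagonal_one, Matrix.mul_one, Matrix.mul_assoc, hAG]

end Matrix

/-- `U diag(c) U†`. -/
noncomputable def spectralMatrix {n N : ℕ} (U : Matrix (Fin n) (Fin N) ℂ) (c : Fin N → ℝ) :
    Matrix (Fin n) (Fin n) ℂ :=
  U * Matrix.diagonal (fun i => (c i : ℂ)) * U.conjTranspose


/-! ### Spectral calculus and water filling for white noise. -/

variable {m n N : ℕ}

theorem posSemidef_spectralMatrix (U : Matrix (Fin n) (Fin N) ℂ) {c : Fin N → ℝ}
    (hc : ∀ i, 0 ≤ c i) : (spectralMatrix U c).PosSemidef :=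
  (PosSemidef.diagonal (d := fun i => (c i : ℂ))
    (fun i => by simpa using hc i)).mul_mul_conjTranspose_same U

theorem spectralMatrix_mul {U : Matrix (Fin n) (Fin N) ℂ} (hU : Uᴴ * U = 1) (c d : Fin N → ℝ) :
    spectralMatrix U c * spectralMatrix U d = spectralMatrix U (fun i => c i * d i) := by
  unfold spectralMatrix
  calc U * diagonal (fun i => (c i : ℂ)) * Uᴴ * (U * diagonal (fun i => (d i : ℂ)) * Uᴴ)
      = U * diagonal (fun i => (c i : ℂ)) * (Uᴴ * U) * diagonal (fun i => (d i : ℂ)) * Uᴴ := by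
        simp only [Matrix.mul_assoc]
    _ = _ := by
        rw [hU, Matrix.mul_one, Matrix.mul_assoc U, diagonal_mul_diagonal]
        simp

theorem spectralMatrix_add (U : Matrix (Fin n) (Fin N) ℂ) (c d : Fin N → ℝ) :
    spectralMatrix U c + spectralMatrix U d = spectralMatrix U (fun i => c i + d i) := by
  unfold spectralMatrix
  rw [← Matrix.add_mul, ← Matrix.mul_add, diagonal_add]
  simp

theorem smul_spectralMatrix (U : Matrix (Fin n) (Fin N) ℂ) (w : ℝ) (c : Fin N → ℝ) :
    w • spectralMatrix U c = spectralMatrix U (fun i => w * c i) := by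
  unfold spectralMatrix
  rw [← Matrix.smul_mul, ← Matrix.mul_smul, ← diagonal_smul]
  congr 3
  ext i
  simp

/-- `U` need not be square, so the projection `1 - U * Uᴴ` is split off before the eigenvalues `1 -
c i` are used. -/
theorem posSemidef_one_sub_spectralMatrix {U : Matrix (Fin n) (Fin N) ℂ} (hU : Uᴴ * U = 1)
    {c : Fin N → ℝ} (hc : ∀ i, c i ≤ 1) : (1 - spectralMatrix U c).PosSemidef := by
  have h1 : (1 - spectralMatrix U fun _ => 1).PosSemidef := by
    have h2 : (1 - U * Uᴴ)ᴴ * (1 - U * Uᴴ) = 1 - spectralMatrix U fun _ => 1 := by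
      have : U * Uᴴ * (U * Uᴴ) = U * Uᴴ := by
        rw [Matrix.mul_assoc, ← Matrix.mul_assoc Uᴴ, hU, Matrix.one_mul]
      simp [spectralMatrix, Matrix.mul_sub, Matrix.sub_mul, this]
    rw [← h2]
    exact posSemidef_conjTranspose_mul_self _
  have h3 : 1 - spectralMatrix U c =
      (1 - spectralMatrix U fun _ => 1) + spectralMatrix U fun i => 1 - c i := by
    have := spectralMatrix_add U c fun i => 1 - c i
    simp only [add_sub_cancel] at this
    rw [← this]
    abel
  rw [h3]
  exact h1.add (posSemidef_spectralMatrix U fun i => sub_nonneg.2 (hc i))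

theorem IsThinSVD.conj_left {A : Matrix (Fin m) (Fin n) ℂ} {E : Matrix (Fin m) (Fin N) ℂ}
    {δ : Fin N → ℝ} {G : Matrix (Fin n) (Fin N) ℂ} (h : IsThinSVD A E δ G) (c : Fin N → ℝ) :
    A * spectralMatrix G c * Aᴴ = spectralMatrix E (fun i => δ i ^ 2 * c i) := by
  have hD : (diagonal (fun i => (δ i : ℂ)))ᴴ = diagonal (fun i => (δ i : ℂ)) := by
    rw [diagonal_conjTranspose]; congr 1; ext i; simp
  rw [h.eq]
  simp only [conjTranspose_mul, conjTranspose_conjTranspose, hD, spectralMatrix]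
  set D := diagonal (fun i => (δ i : ℂ)) with hDe
  calc E * D * Gᴴ * (G * diagonal (fun i => (c i : ℂ)) * Gᴴ) * (G * (D * Eᴴ))
      = E * D * (Gᴴ * G) * diagonal (fun i => (c i : ℂ)) * (Gᴴ * G) * D * Eᴴ := by
        simp only [Matrix.mul_assoc]
    _ = E * (D * diagonal (fun i => (c i : ℂ)) * D) * Eᴴ := by
        rw [h.right_orthonormal]; simp only [Matrix.mul_assoc, Matrix.one_mul]
    _ = _ := by
        rw [hDe, diagonal_mul_diagonal, diagonal_mul_diagonal]
        congr 3
        ext i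
        push_cast
        ring

theorem IsThinSVD.symm {A : Matrix (Fin m) (Fin n) ℂ} {E : Matrix (Fin m) (Fin N) ℂ}
    {δ : Fin N → ℝ} {G : Matrix (Fin n) (Fin N) ℂ} (h : IsThinSVD A E δ G) :
    IsThinSVD Aᴴ G δ E where
  left_orthonormal := h.right_orthonormal
  right_orthonormal := h.left_orthonormal
  pos := h.pos
  eq := by
    have hD : (diagonal (fun i => (δ i : ℂ)))ᴴ = diagonal (fun i => (δ i : ℂ)) := by
      rw [diagonal_conjTranspose]; congr 1; ext i; simp
    rw [h.eq]
    simp only [conjTranspose_mul, conjTranspose_conjTranspose, hD, Matrix.mul_assoc]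

theorem IsThinSVD.conj_right {A : Matrix (Fin m) (Fin n) ℂ} {E : Matrix (Fin m) (Fin N) ℂ}
    {δ : Fin N → ℝ} {G : Matrix (Fin n) (Fin N) ℂ} (h : IsThinSVD A E δ G) (c : Fin N → ℝ) :
    Aᴴ * spectralMatrix E c * A = spectralMatrix G (fun i => δ i ^ 2 * c i) := by
  simpa using h.symm.conj_left c

theorem inv_one_add_spectralMatrix {U : Matrix (Fin n) (Fin N) ℂ} (hU : Uᴴ * U = 1)
    {c : Fin N → ℝ} (hc : ∀ i, 0 ≤ c i) :
    (1 + spectralMatrix U c)⁻¹ = 1 - spectralMatrix U (fun i => c i / (1 + c i)) := by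
  apply inv_eq_right_inv
  rw [Matrix.add_mul, Matrix.mul_sub, Matrix.mul_sub, spectralMatrix_mul hU, Matrix.one_mul,
    Matrix.one_mul, Matrix.mul_one]
  have := spectralMatrix_add U (fun i => c i / (1 + c i)) (fun i => c i * (c i / (1 + c i)))
  have h2 : (fun i => c i / (1 + c i) + c i * (c i / (1 + c i))) = c := by
    ext i
    have : 1 + c i ≠ 0 := by have := hc i; positivity
    field_simp
  rw [h2] at this
  rw [← this]
  abel

theorem waterFilling_eq_spectralMatrix (w : ℝ) (δ : Fin N → ℝ) (U : Matrix (Fin n) (Fin N) ℂ) :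
    waterFilling w δ U = spectralMatrix U (fun i => max (w - (δ i ^ 2)⁻¹) 0) := rfl

theorem posSemidef_waterFilling (w : ℝ) (δ : Fin N → ℝ) (U : Matrix (Fin n) (Fin N) ℂ) :
    (waterFilling w δ U).PosSemidef :=
  posSemidef_spectralMatrix U fun _ => le_max_right _ _

variable {A : Matrix (Fin m) (Fin n) ℂ} {E : Matrix (Fin m) (Fin N) ℂ} {δ : Fin N → ℝ}
  {G : Matrix (Fin n) (Fin N) ℂ}

theorem IsThinSVD.inv_one_add_waterFilling (h : IsThinSVD A E δ G) (w : ℝ) :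
    (1 + A * waterFilling w δ G * Aᴴ)⁻¹ = 1 - spectralMatrix E (fun i =>
      δ i ^ 2 * max (w - (δ i ^ 2)⁻¹) 0 / (1 + δ i ^ 2 * max (w - (δ i ^ 2)⁻¹) 0)) := by
  rw [waterFilling_eq_spectralMatrix, h.conj_left, inv_one_add_spectralMatrix h.left_orthonormal]
  intro i
  positivity

/-- Water filling solves the optimality conditions for white noise. -/
theorem IsThinSVD.isKKT_waterFilling (h : IsThinSVD A E δ G) (w : ℝ) :
    IsKKT w A 1 1 (waterFilling w δ G) := by
  have hM : w • (Aᴴ * (1 + A * waterFilling w δ G * Aᴴ)⁻¹ * A) = spectralMatrix G (fun i =>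
      w * (δ i ^ 2 / (1 + δ i ^ 2 * max (w - (δ i ^ 2)⁻¹) 0))) := by
    rw [h.inv_one_add_waterFilling, Matrix.mul_sub, Matrix.sub_mul, h.conj_right, Matrix.mul_one]
    have h1 : Aᴴ * A = spectralMatrix G (fun i => δ i ^ 2) := by
      have h2 := h.conj_right (fun _ => 1)
      have h3 : A = E * Eᴴ * A := by
        conv_rhs => rw [h.eq]
        rw [Matrix.mul_assoc E (diagonal _), ← Matrix.mul_assoc, Matrix.mul_assoc E,
          h.left_orthonormal, Matrix.mul_one, ← Matrix.mul_assoc, ← h.eq]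
      simp only [mul_one] at h2
      rw [← h2]
      conv_lhs => arg 2; rw [h3]
      simp [spectralMatrix, Matrix.mul_assoc]
    rw [h1, ← smul_spectralMatrix]
    congr 1
    rw [sub_eq_iff_eq_add, spectralMatrix_add]
    congr 1
    ext i
    have : 1 + δ i ^ 2 * max (w - (δ i ^ 2)⁻¹) 0 ≠ 0 := by positivity
    field_simp
  constructor
  · rw [hM]
    refine posSemidef_one_sub_spectralMatrix h.right_orthonormal fun i => ?_
    have h0 := h.pos i
    have h1 : 0 < 1 + δ i ^ 2 * max (w - (δ i ^ 2)⁻¹) 0 := by positivity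
    rw [← mul_div_assoc, div_le_one h1]
    have h2 := mul_le_mul_of_nonneg_left (le_max_left (w - (δ i ^ 2)⁻¹) 0) (sq_nonneg (δ i))
    -- The required bound is `w δ² ≤ 1 + δ² max (w - δ⁻²) 0`, with equality on the channels that
    -- carry power.
    have h3 : δ i ^ 2 * (w - (δ i ^ 2)⁻¹) = w * δ i ^ 2 - 1 := by field_simp
    linarith
  · rw [hM, Matrix.mul_sub, Matrix.mul_one, waterFilling_eq_spectralMatrix,
      spectralMatrix_mul h.right_orthonormal, sub_eq_zero]
    congr 1
    ext i
    have h0 := h.pos i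
    -- Either the slack eigenvalue is zero or the power is zero.
    rcases max_cases (w - (δ i ^ 2)⁻¹) 0 with ⟨h1, -⟩ | ⟨h1, -⟩ <;> rw [h1]
    · have h3 : 1 + δ i ^ 2 * (w - (δ i ^ 2)⁻¹) = w * δ i ^ 2 := by field_simp; ring
      rw [h3, ← mul_div_assoc]
      by_cases hw : w = 0
      · subst hw
        have : max (0 - (δ i ^ 2)⁻¹) 0 = 0 := max_eq_right (by simp; positivity)
        rw [← h1, this]; simp
      · field_simp
    · simp

/-- With `c = w - δ⁻²` one has `1 + δ² c = w δ²`, so `w δ² c / (1 + δ² c) = c`: primal and dual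
powers agree channel by channel. This is the source of (D). -/
theorem IsThinSVD.waterFilling_left (h : IsThinSVD A E δ G) (w : ℝ) :
    w • (1 - (1 + A * waterFilling w δ G * Aᴴ)⁻¹) = waterFilling w δ E := by
  rw [h.inv_one_add_waterFilling, sub_sub_cancel, smul_spectralMatrix,
    waterFilling_eq_spectralMatrix]
  congr 1
  ext i
  have h0 := h.pos i
  rcases max_cases (w - (δ i ^ 2)⁻¹) 0 with ⟨h1, -⟩ | ⟨h1, -⟩ <;> rw [h1]
  · have h3 : 1 + δ i ^ 2 * (w - (δ i ^ 2)⁻¹) = w * δ i ^ 2 := by field_simp; ring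
    rw [h3]
    by_cases hw : w = 0
    · subst hw
      have : max (0 - (δ i ^ 2)⁻¹) 0 = 0 := max_eq_right (by simp; positivity)
      rw [← h1, this]; simp
    · field_simp
  · simp

/-! ### Derivatives of determinants and log-determinants. -/

theorem hasDerivAt_det_add_smul {n : Type*} [Fintype n] [DecidableEq n] {A : Matrix n n ℂ}
    (hA : IsUnit A.det) (B : Matrix n n ℂ) :
    HasDerivAt (fun x : ℝ => (A + x • B).det) (A.det * (A⁻¹ * B).trace) 0 := by
  set P := (det (1 + (Polynomial.X : Polynomial ℂ) • (A⁻¹ * B).map Polynomial.C)).divX.divX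
  have h : ∀ x : ℝ, (A + x • B).det =
      A.det * (1 + (A⁻¹ * B).trace * (x : ℂ) + P.eval (x : ℂ) * (x : ℂ) ^ 2) := by
    intro x
    rw [← det_one_add_smul, ← det_mul, Matrix.mul_add, Matrix.mul_one, Matrix.mul_smul,
      ← Matrix.mul_assoc, Matrix.mul_nonsing_inv _ hA, Matrix.one_mul]
    congr 2
  have h1 : HasDerivAt (fun z : ℂ => A.det * (1 + (A⁻¹ * B).trace * z + P.eval z * z ^ 2))
      (A.det * (A⁻¹ * B).trace) ((0 : ℝ) : ℂ) := by
    have := ((((hasDerivAt_id ((0 : ℝ) : ℂ)).const_mul (A⁻¹ * B).trace).const_add 1).add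
      ((P.hasDerivAt ((0 : ℝ) : ℂ)).mul (hasDerivAt_pow 2 ((0 : ℝ) : ℂ)))).const_mul A.det
    refine this.congr_deriv ?_
    simp
  simpa only [h] using h1.comp_ofReal

/-- The determinant is the quotient of `det (B + P + x (B' + P'))` by `det (B + x B')`, and its
logarithmic derivative is a difference of traces. -/
theorem hasDerivAt_log_det_one_add {n : Type*} [Fintype n] [DecidableEq n] {P B : Matrix n n ℂ}
    (hB : B.PosDef) (hP : P.PosSemidef) (P' B' : Matrix n n ℂ) :
    HasDerivAt (fun x : ℝ => Real.log (1 + (P + x • P') * (B + x • B')⁻¹).det.re)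
      (((B + P)⁻¹ * (B' + P')).trace.re - (B⁻¹ * B').trace.re) 0 := by
  have hX := hB.add_posSemidef hP
  have h1 := hasDerivAt_det_add_smul hB.isUnit_det B'
  have h2 := hasDerivAt_det_add_smul hX.isUnit_det (B' + P')
  have hB0 : B.det ≠ 0 := hB.isUnit_det.ne_zero
  have hX0 : (B + P).det ≠ 0 := hX.isUnit_det.ne_zero
  -- The quotient form needs `B + x • B'` invertible, which is known only near `x = 0`.
  have hev : (fun x : ℝ => (1 + (P + x • P') * (B + x • B')⁻¹).det) =ᶠ[nhds 0]
      fun x => (B + P + x • (B' + P')).det / (B + x • B').det := by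
    have hne : ∀ᶠ x in nhds (0 : ℝ), (B + x • B').det ≠ 0 :=
      h1.continuousAt.eventually_ne (by simpa using hB0)
    filter_upwards [hne] with x hx
    have hu : IsUnit (B + x • B').det := isUnit_iff_ne_zero.2 hx
    rw [eq_div_iff hx, ← det_mul, Matrix.add_mul, Matrix.one_mul, Matrix.mul_assoc,
      Matrix.nonsing_inv_mul _ hu, Matrix.mul_one, smul_add]
    congr 1
    abel
  have h3 := (h2.div h1 (by simpa using hB0)).congr_of_eventuallyEq hev
  have h4 : HasDerivAt (fun x : ℝ => (1 + (P + x • P') * (B + x • B')⁻¹).det.re) _ 0 :=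
    Complex.reCLM.hasFDerivAt.comp_hasDerivAt (0 : ℝ) h3
  have hv : (1 + (P + (0 : ℝ) • P') * (B + (0 : ℝ) • B')⁻¹).det = (B + P).det / B.det := by
    simpa using hev.self_of_nhds
  -- Positivity in `ℂ` includes reality, so the value at `0` is a real `c` that passes through the
  -- real part.
  have hpos : 0 < (B + P).det / B.det := div_pos hX.det_pos hB.det_pos
  obtain ⟨c, hc⟩ : ∃ c : ℝ, (B + P).det / B.det = c :=
    ⟨((B + P).det / B.det).re, Complex.ext rfl (Complex.nonneg_iff.1 hpos.le).2.symm⟩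
  have hc0 : 0 < c := by rw [hc] at hpos; exact_mod_cast hpos
  have h5 := h4.log (by rw [hv, hc]; simpa using hc0.ne')
  convert h5 using 1
  rw [hv, hc]
  have hXc : (B + P).det = c * B.det := by rw [← hc]; field_simp
  simp only [zero_smul, add_zero, Complex.reCLM_apply, Complex.ofReal_re]
  have : ((B + P).det * ((B + P)⁻¹ * (B' + P')).trace * B.det -
      (B + P).det * (B.det * (B⁻¹ * B').trace)) / B.det ^ 2 =
      (c : ℂ) * (((B + P)⁻¹ * (B' + P')).trace - (B⁻¹ * B').trace) := by
    rw [hXc]; field_simp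
  rw [this, Complex.re_ofReal_mul, Complex.sub_re]
  field_simp

theorem sum_update_add_smul {L : ℕ} {n : Fin L → ℕ} {V : Type*} [AddCommGroup V] [Module ℝ V]
    (f : ∀ k, Matrix (Fin (n k)) (Fin (n k)) ℂ → V) (S : CovFamily n) (l : Fin L) (x : ℝ)
    (D : Matrix (Fin (n l)) (Fin (n l)) ℂ) {g : V}
    (h : f l (S l + x • D) = f l (S l) + x • g) :
    ∑ k, f k (Function.update S l (S l + x • D) k) = ∑ k, f k (S k) + x • g := by
  rw [← Finset.add_sum_erase _ _ (Finset.mem_univ l),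
    ← Finset.add_sum_erase _ (fun k => f k (S k)) (Finset.mem_univ l), Function.update_self, h]
  have : ∑ k ∈ Finset.univ.erase l, f k (Function.update S l (S l + x • D) k) =
      ∑ k ∈ Finset.univ.erase l, f k (S k) :=
    Finset.sum_congr rfl fun k hk => by
      rw [Function.update_of_ne (Finset.ne_of_mem_erase hk)]
  rw [this]
  abel

/-! ### The gradient of the Lagrangian and stationarity. -/

namespace RelayNetwork


variable (N : RelayNetwork) (w : Fin N.L → ℝ) (F : N.Precoding) (S : CovFamily N.tx)

theorem dualChannel_dualPrecoding (l k : Fin N.L) :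
    N.dualChannel (N.dualPrecoding F) l k = (N.eqChannel F k l)ᴴ := by
  simp [dualChannel, dualB, dualPrecoding, eqChannel, Matrix.mul_assoc]

theorem dualOmega_dualPrecoding (Sh : CovFamily N.rx) (l : Fin N.L) :
    N.dualOmega (N.dualPrecoding F) Sh l = N.eqConstraint F l +
      ∑ k, N.Φ k l • ((N.eqChannel F k l)ᴴ * Sh k * N.eqChannel F k l) := by
  simp only [dualOmega, dualChannel_dualPrecoding, conjTranspose_conjTranspose, eqConstraint]
  simp only [dualB, dualPrecoding, conjTranspose_conjTranspose]
  abel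

theorem Φ_nonneg (l k : Fin N.L) : 0 ≤ N.Φ l k := by
  rcases N.Φ_binary l k with h | h <;> simp [h]

variable {N F S}

theorem posDef_Omega (hW : ∀ l, (N.eqNoise F l).PosDef) (hS : ∀ l, (S l).PosSemidef)
    (l : Fin N.L) : (N.Omega F S l).PosDef :=
  (hW l).add_posSemidef (posSemidef_sum _ fun k _ =>
    ((hS k).mul_mul_conjTranspose_same _).smul (N.Φ_nonneg l k))

theorem posDef_dualOmega (hWhat : ∀ l, (N.eqConstraint F l).PosDef) {Sh : CovFamily N.rx}
    (hSh : ∀ l, (Sh l).PosSemidef) (l : Fin N.L) :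
    (N.dualOmega (N.dualPrecoding F) Sh l).PosDef := by
  rw [dualOmega_dualPrecoding]
  exact (hWhat l).add_posSemidef (posSemidef_sum _ fun k _ =>
    ((hSh k).conjTranspose_mul_mul_same _).smul (N.Φ_nonneg k l))

theorem posSemidef_explicitDual {w : Fin N.L → ℝ} (hw : ∀ l, 0 ≤ w l)
    (hW : ∀ l, (N.eqNoise F l).PosDef) (hS : ∀ l, (S l).PosSemidef) (l : Fin N.L) :
    (N.explicitDual w F S l).PosSemidef :=
  ((posDef_Omega hW hS l).posSemidef_inv_sub_inv_add
    ((hS l).mul_mul_conjTranspose_same _)).smul (hw l)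

theorem Omega_update (l k : Fin N.L) (x : ℝ) (D : Matrix (Fin (N.tx l)) (Fin (N.tx l)) ℂ) :
    N.Omega F (Function.update S l (S l + x • D)) k = N.Omega F S k +
      x • (N.Φ k l • (N.eqChannel F k l * D * (N.eqChannel F k l)ᴴ)) := by
  unfold Omega
  rw [sum_update_add_smul (fun j A => N.Φ k j • (N.eqChannel F k j * A * (N.eqChannel F k j)ᴴ))
    (g := N.Φ k l • (N.eqChannel F k l * D * (N.eqChannel F k l)ᴴ)), add_assoc]
  rw [Matrix.mul_add, Matrix.add_mul, smul_add, Matrix.mul_smul, Matrix.smul_mul, smul_comm]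

theorem relayCov_update (l : Fin N.L) (q : ℕ) (x : ℝ)
    (D : Matrix (Fin (N.tx l)) (Fin (N.tx l)) ℂ) :
    N.relayCov F (Function.update S l (S l + x • D)) q = N.relayCov F S q +
      x • (N.B F 1 q * N.H0 l * D * (N.H0 l)ᴴ * (N.B F 1 q)ᴴ) := by
  unfold relayCov
  rw [sum_update_add_smul (fun j A => N.B F 1 q * N.H0 j * A * (N.H0 j)ᴴ * (N.B F 1 q)ᴴ)
    (g := N.B F 1 q * N.H0 l * D * (N.H0 l)ᴴ * (N.B F 1 q)ᴴ), add_right_comm]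
  simp only [Matrix.mul_add, Matrix.add_mul, Matrix.mul_smul, Matrix.smul_mul]

/-- The input of link `l` enters the rate of link `k` as signal when `k = l` and as interference
through `N.Φ k l`. -/
theorem hasDerivAt_rate_update (hW : ∀ l, (N.eqNoise F l).PosDef) (hS : ∀ l, (S l).PosSemidef)
    (l k : Fin N.L) (D : Matrix (Fin (N.tx l)) (Fin (N.tx l)) ℂ) :
    HasDerivAt (fun x : ℝ => N.rate F (Function.update S l (S l + x • D)) k)
      ((((if k = l then (1 : ℝ) else 0) • ((N.eqChannel F l l)ᴴ *
          (N.Omega F S l + N.eqChannel F l l * S l * (N.eqChannel F l l)ᴴ)⁻¹ * N.eqChannel F l l) -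
        N.Φ k l • ((N.eqChannel F k l)ᴴ * ((N.Omega F S k)⁻¹ - (N.Omega F S k +
          N.eqChannel F k k * S k * (N.eqChannel F k k)ᴴ)⁻¹) * N.eqChannel F k l)) * D).trace.re)
      0 := by
  have hΩ := posDef_Omega hW hS k
  have hP := (hS k).mul_mul_conjTranspose_same (N.eqChannel F k k)
  have key := hasDerivAt_log_det_one_add hΩ hP
    ((if k = l then (1 : ℝ) else 0) • (N.eqChannel F k l * D * (N.eqChannel F k l)ᴴ))
    (N.Φ k l • (N.eqChannel F k l * D * (N.eqChannel F k l)ᴴ))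
  have hcyc : ∀ M : Matrix (Fin (N.rx k)) (Fin (N.rx k)) ℂ,
      (M * (N.eqChannel F k l * D * (N.eqChannel F k l)ᴴ)).trace =
      ((N.eqChannel F k l)ᴴ * M * N.eqChannel F k l * D).trace := by
    intro M
    rw [← Matrix.mul_assoc, trace_mul_comm]
    simp only [Matrix.mul_assoc]
  convert key using 1
  · ext x
    rw [rate, Omega_update]
    congr 3
    by_cases h : k = l
    · subst h
      simp [Matrix.mul_add, Matrix.add_mul]
    · simp [h]
  · rw [Matrix.mul_add, trace_add]
    simp only [Matrix.mul_smul, trace_smul, hcyc, Complex.add_re, Complex.smul_re, Matrix.sub_mul,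
      trace_sub, Matrix.smul_mul, Matrix.mul_sub, Complex.sub_re, smul_sub]
    by_cases h : k = l
    · subst h
      simp only [if_true, smul_eq_mul]; ring
    · simp only [h, if_false, smul_eq_mul]; ring

theorem trace_eqConstraint_mul (l : Fin N.L) (D : Matrix (Fin (N.tx l)) (Fin (N.tx l)) ℂ) :
    (N.eqConstraint F l * D).trace.re = (D * N.What0 l).trace.re +
      ∑ q ∈ Finset.Icc 1 N.Q,
        (N.B F 1 q * N.H0 l * D * (N.H0 l)ᴴ * (N.B F 1 q)ᴴ * N.What q).trace.re := by
  rw [eqConstraint, Matrix.add_mul, trace_add, Finset.sum_mul, trace_sum, Complex.add_re,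
    Complex.re_sum, add_comm, trace_mul_comm D]
  congr 1
  refine Finset.sum_congr rfl fun q _ => ?_
  congr 1
  rw [trace_mul_comm _ (N.What q), Matrix.mul_assoc _ (N.H0 l) D, Matrix.mul_assoc _ _ (N.H0 l * D),
    Matrix.mul_assoc _ (N.What q), trace_mul_comm]
  simp only [Matrix.mul_assoc]

/-- The losses inflicted on the other links are the dual interference generated by `explicitDual`,
and the relay power costs combine with the source cost into `eqConstraint`. Together they form
`dualOmega`. -/
theorem isPartialGradient_lagrangian (hW : ∀ l, (N.eqNoise F l).PosDef)
    (hWhat : ∀ l, (N.eqConstraint F l).PosDef) (hw : ∀ l, 0 ≤ w l)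
    (hS : ∀ l, (S l).PosSemidef) (l : Fin N.L) :
    IsPartialGradient (N.lagrangian w F) S l
      (-(N.dualOmega (N.dualPrecoding F) (N.explicitDual w F S) l - w l •
        ((N.eqChannel F l l)ᴴ * (N.Omega F S l + N.eqChannel F l l * S l * (N.eqChannel F l l)ᴴ)⁻¹ *
          N.eqChannel F l l))) := by
  have hX := (posDef_Omega hW hS l).add_posSemidef
    ((hS l).mul_mul_conjTranspose_same (N.eqChannel F l l))
  constructor
  · refine ((posDef_dualOmega hWhat (posSemidef_explicitDual hw hW hS) l).isHermitian.sub
      (IsHermitian.smul ?_ (IsSelfAdjoint.all _))).neg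
    exact isHermitian_conjTranspose_mul_mul _ hX.inv.isHermitian
  intro D _
  have h1 := HasDerivAt.fun_sum (u := Finset.univ)
    fun k _ => (hasDerivAt_rate_update hW hS l k D).const_mul (w k)
  have h2 : HasDerivAt (fun x : ℝ => ∑ k, (Function.update S l (S l + x • D) k *
      N.What0 k).trace.re) (D * N.What0 l).trace.re 0 := by
    have e : ∀ x : ℝ, ∑ k, (Function.update S l (S l + x • D) k * N.What0 k).trace.re =
        ∑ k, (S k * N.What0 k).trace.re + x * (D * N.What0 l).trace.re := fun x =>
      sum_update_add_smul (fun k A => (A * N.What0 k).trace.re) S l x D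
        (by simp [Matrix.add_mul])
    simp only [e]
    simpa using ((hasDerivAt_id (0 : ℝ)).mul_const (D * N.What0 l).trace.re).const_add
      (∑ k, (S k * N.What0 k).trace.re)
  have h3 : HasDerivAt (fun x : ℝ => ∑ q ∈ Finset.Icc 1 N.Q,
      (N.relayCov F (Function.update S l (S l + x • D)) q * N.What q).trace.re)
      (∑ q ∈ Finset.Icc 1 N.Q,
        (N.B F 1 q * N.H0 l * D * (N.H0 l)ᴴ * (N.B F 1 q)ᴴ * N.What q).trace.re) 0 := by
    refine HasDerivAt.fun_sum fun q _ => ?_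
    simp only [relayCov_update, Matrix.add_mul, Matrix.smul_mul, trace_add, trace_smul,
      Complex.add_re, Complex.smul_re]
    simpa using ((hasDerivAt_id (0 : ℝ)).mul_const
      (N.B F 1 q * N.H0 l * D * (N.H0 l)ᴴ * (N.B F 1 q)ᴴ * N.What q).trace.re).const_add
      (N.relayCov F S q * N.What q).trace.re
  refine ((h1.sub h2).sub h3).congr_deriv ?_
  have hG : -(N.dualOmega (N.dualPrecoding F) (N.explicitDual w F S) l - w l •
        ((N.eqChannel F l l)ᴴ * (N.Omega F S l + N.eqChannel F l l * S l * (N.eqChannel F l l)ᴴ)⁻¹ *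
          N.eqChannel F l l)) =
      ∑ k, w k • ((if k = l then (1 : ℝ) else 0) • ((N.eqChannel F l l)ᴴ *
          (N.Omega F S l + N.eqChannel F l l * S l * (N.eqChannel F l l)ᴴ)⁻¹ * N.eqChannel F l l) -
        N.Φ k l • ((N.eqChannel F k l)ᴴ * ((N.Omega F S k)⁻¹ - (N.Omega F S k +
          N.eqChannel F k k * S k * (N.eqChannel F k k)ᴴ)⁻¹) * N.eqChannel F k l)) -
      N.eqConstraint F l := by
    simp only [smul_sub, Finset.sum_sub_distrib, ite_smul, one_smul, zero_smul, smul_ite,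
      smul_zero, Finset.sum_ite_eq', Finset.mem_univ, if_true]
    rw [dualOmega_dualPrecoding]
    simp only [explicitDual, Matrix.mul_smul, Matrix.smul_mul, smul_smul,
      mul_comm (N.Φ _ _)]
    abel
  rw [sub_sub, ← trace_eqConstraint_mul, hG, Matrix.sub_mul, trace_sub, Complex.sub_re,
    Finset.sum_mul, trace_sum, Complex.re_sum]
  congr 1
  refine Finset.sum_congr rfl fun k _ => ?_
  rw [Matrix.smul_mul, trace_smul, Complex.smul_re, smul_eq_mul]

/-- The difference of two gradients is itself an admissible Hermitian direction, and testing against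
it gives its squared Frobenius norm. -/
theorem _root_.IsPartialGradient.unique {L : ℕ} {n : Fin L → ℕ} {f : CovFamily n → ℝ}
    {S : CovFamily n} {l : Fin L} {G₁ G₂ : Matrix (Fin (n l)) (Fin (n l)) ℂ}
    (h₁ : IsPartialGradient f S l G₁) (h₂ : IsPartialGradient f S l G₂) : G₁ = G₂ := by
  have hD := h₁.1.sub h₂.1
  have h := (h₁.2 _ hD).unique (h₂.2 _ hD)
  rw [← sub_eq_zero, ← Complex.sub_re, ← trace_sub, ← Matrix.sub_mul] at h
  have h0 : 0 ≤ ((G₁ - G₂)ᴴ * (G₁ - G₂)).trace :=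
    (posSemidef_conjTranspose_mul_self (G₁ - G₂)).trace_nonneg
  have h1 : ((G₁ - G₂)ᴴ * (G₁ - G₂)).trace = 0 := by
    refine Complex.ext ?_ (Complex.nonneg_iff.1 h0).2.symm
    rw [hD.eq]; exact h
  exact sub_eq_zero.1 (trace_conjTranspose_mul_self_eq_zero_iff.1 h1)

theorem isStationary_iff (hW : ∀ l, (N.eqNoise F l).PosDef)
    (hWhat : ∀ l, (N.eqConstraint F l).PosDef) (hw : ∀ l, 0 ≤ w l) :
    N.IsStationary w F S ↔ (∀ l, (S l).PosSemidef) ∧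
      ∀ l, IsKKT (w l) (N.eqChannel F l l) (N.Omega F S l)
        (N.dualOmega (N.dualPrecoding F) (N.explicitDual w F S) l) (S l) := by
  refine and_congr_right fun hS => forall_congr' fun l => ?_
  have hG := isPartialGradient_lagrangian w hW hWhat hw hS l
  constructor
  · rintro ⟨G, h, hp, ht⟩
    rw [h.unique hG] at hp ht
    rw [neg_neg] at hp
    rw [Matrix.mul_neg, trace_neg, neg_eq_zero] at ht
    exact ⟨hp, (hS l).mul_eq_zero_of_trace hp ht⟩
  · intro h
    refine ⟨_, hG, ?_, ?_⟩
    · rw [neg_neg]; exact h.posSemidef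
    · rw [Matrix.mul_neg, h.mul_eq_zero]; simp

end RelayNetwork

/-! ### Hermitian forms, and matrices with nonpositive off-diagonal entries. -/

namespace Matrix

/-- The real part of the Hermitian form `v† A v`. -/
noncomputable def formRe {n : Type*} [Fintype n] (A : Matrix n n ℂ) (v : n → ℂ) : ℝ :=
  (star v ⬝ᵥ A *ᵥ v).re

variable {m n : Type*} [Fintype m] [Fintype n]

theorem formRe_add (A B : Matrix n n ℂ) (v : n → ℂ) :
    formRe (A + B) v = formRe A v + formRe B v := by
  simp [formRe, add_mulVec]

theorem formRe_sub (A B : Matrix n n ℂ) (v : n → ℂ) :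
    formRe (A - B) v = formRe A v - formRe B v := by
  simp [formRe, sub_mulVec]

theorem formRe_smul (c : ℝ) (A : Matrix n n ℂ) (v : n → ℂ) :
    formRe (c • A) v = c * formRe A v := by
  simp [formRe, smul_mulVec]

theorem formRe_ofReal_smul (c : ℝ) (A : Matrix n n ℂ) (v : n → ℂ) :
    formRe ((c : ℂ) • A) v = c * formRe A v := by
  simp [formRe, smul_mulVec]

theorem formRe_sum {ι : Type*} (s : Finset ι) (A : ι → Matrix n n ℂ) (v : n → ℂ) :
    formRe (∑ i ∈ s, A i) v = ∑ i ∈ s, formRe (A i) v := by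
  simp [formRe, sum_mulVec, dotProduct_sum]

theorem norm_star_dotProduct_comm (u v : n → ℂ) : ‖star u ⬝ᵥ v‖ = ‖star v ⬝ᵥ u‖ := by
  rw [← norm_star, star_dotProduct, star_star, dotProduct_comm]

theorem formRe_vecMulVec (u v : n → ℂ) :
    formRe (vecMulVec u (star u)) v = ‖star v ⬝ᵥ u‖ ^ 2 := by
  have h : star u ⬝ᵥ v = star (star v ⬝ᵥ u) := by rw [star_dotProduct]
  rw [formRe, vecMulVec_mulVec, dotProduct_smul, h, op_smul_eq_smul, smul_eq_mul,
    mul_comm]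
  change ((star v ⬝ᵥ u) * (starRingEnd ℂ) (star v ⬝ᵥ u)).re = _
  rw [Complex.mul_conj, Complex.ofReal_re, Complex.normSq_eq_norm_sq]

theorem formRe_conjTranspose_mul_mul (A : Matrix m m ℂ) (B : Matrix m n ℂ) (v : n → ℂ) :
    formRe (Bᴴ * A * B) v = formRe A (B *ᵥ v) := by
  rw [formRe, formRe, star_mulVec, ← dotProduct_mulVec, mulVec_mulVec, mulVec_mulVec,
    Matrix.mul_assoc]

theorem PosSemidef.formRe_nonneg {A : Matrix n n ℂ} (hA : A.PosSemidef) (v : n → ℂ) :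
    0 ≤ formRe A v :=
  hA.re_dotProduct_nonneg v

theorem PosDef.formRe_pos {A : Matrix n n ℂ} (hA : A.PosDef) {v : n → ℂ} (hv : v ≠ 0) :
    0 < formRe A v :=
  hA.re_dotProduct_pos hv

theorem PosSemidef.dotProduct_mulVec_eq_formRe {A : Matrix n n ℂ} (hA : A.PosSemidef)
    (v : n → ℂ) : star v ⬝ᵥ A *ᵥ v = (formRe A v : ℂ) :=
  Complex.ext rfl (Complex.nonneg_iff.1 (hA.dotProduct_mulVec_nonneg v)).2.symm

theorem ne_zero_of_star_dotProduct_self {v : n → ℂ} (h : star v ⬝ᵥ v = 1) : v ≠ 0 := by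
  rintro rfl
  simp at h

theorem exists_smul_star_dotProduct_self {v : n → ℂ} (hv : v ≠ 0) :
    ∃ α : ℂ, star (α • v) ⬝ᵥ (α • v) = 1 := by
  classical
  have h1 : star v ⬝ᵥ v = (formRe 1 v : ℂ) := by
    rw [← PosSemidef.one.dotProduct_mulVec_eq_formRe, one_mulVec]
  have h2 : 0 < formRe 1 v := PosDef.one.formRe_pos hv
  refine ⟨((√(formRe 1 v))⁻¹ : ℝ), ?_⟩
  rw [star_smul, smul_dotProduct, dotProduct_smul, h1]
  simp only [Complex.star_def, Complex.conj_ofReal, smul_eq_mul]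
  norm_cast
  have h3 := Real.mul_self_sqrt h2.le
  have h4 : √(formRe 1 v) ≠ 0 := (Real.sqrt_pos.2 h2).ne'
  field_simp
  nlinarith

/-- A matrix with nonpositive off-diagonal entries that maps some positive vector to a positive
vector is nonsingular. -/
theorem isUnit_det_of_mulVec_pos [DecidableEq n] {Z : Matrix n n ℝ} {p : n → ℝ}
    (hZ : ∀ i j, i ≠ j → Z i j ≤ 0) (hp : ∀ i, 0 < p i) (hZp : ∀ i, 0 < (Z *ᵥ p) i) :
    IsUnit Z.det := by
  -- Scaling the columns by `p` makes the matrix strictly diagonally dominant by rows.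
  have h : (Z * diagonal p).det ≠ 0 := by
    refine det_ne_zero_of_sum_row_lt_diag fun k => ?_
    have h1 := hZp k
    rw [mulVec, dotProduct, ← Finset.add_sum_erase _ _ (Finset.mem_univ k)] at h1
    have h2 : ∑ j ∈ Finset.univ.erase k, ‖(Z * diagonal p) k j‖ =
        -∑ j ∈ Finset.univ.erase k, Z k j * p j := by
      rw [← Finset.sum_neg_distrib]
      refine Finset.sum_congr rfl fun j hj => ?_
      rw [mul_diagonal, Real.norm_of_nonpos]
      exact mul_nonpos_of_nonpos_of_nonneg (hZ k j (Finset.ne_of_mem_erase hj).symm) (hp j).le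
    rw [h2, mul_diagonal]
    exact lt_of_lt_of_le (by linarith) (Real.le_norm_self _)
  rw [det_mul] at h
  exact isUnit_iff_ne_zero.2 (left_ne_zero_of_mul h)

/-- The inverse transpose of such a matrix is nonnegative. -/
theorem nonneg_of_transpose_mulVec_nonneg {Z : Matrix n n ℝ} {p q : n → ℝ}
    (hZ : ∀ i j, i ≠ j → Z i j ≤ 0) (hp : ∀ i, 0 < p i) (hZp : ∀ i, 0 < (Z *ᵥ p) i)
    (hq : ∀ j, 0 ≤ (Zᵀ *ᵥ q) j) (i : n) : 0 ≤ q i := by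
  classical
  by_contra! hi
  -- The sum of `p j * (Zᵀ *ᵥ q) j` over the negative set `J` of `q` is nonnegative by hypothesis;
  -- regrouped by rows it turns out negative as soon as `J` is nonempty.
  set J := Finset.univ.filter fun j => q j < 0 with hJ
  have h1 : 0 ≤ ∑ j ∈ J, p j * (Zᵀ *ᵥ q) j :=
    Finset.sum_nonneg fun j _ => mul_nonneg (hp j).le (hq j)
  have h2 : ∑ j ∈ J, p j * (Zᵀ *ᵥ q) j = ∑ k, q k * ∑ j ∈ J, Z k j * p j := by
    simp only [mulVec, dotProduct, transpose_apply, Finset.mul_sum]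
    rw [Finset.sum_comm]
    refine Finset.sum_congr rfl fun k _ => Finset.sum_congr rfl fun j _ => by ring
  -- For `k` in `J`, the omitted entries of the row are nonpositive, so the partial row sum is at
  -- least the full, positive one. For `k` outside `J`, only off-diagonal entries occur and `q k ≥
  -- 0`.
  have h3 : ∀ k, q k * ∑ j ∈ J, Z k j * p j ≤ 0 ∧
      (q k < 0 → q k * ∑ j ∈ J, Z k j * p j < 0) := by
    intro k
    have hneg : q k < 0 → q k * ∑ j ∈ J, Z k j * p j < 0 := fun hk => by
      refine mul_neg_of_neg_of_pos hk ((hZp k).trans_le ?_)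
      rw [mulVec, dotProduct, ← Finset.sum_add_sum_compl J]
      refine add_le_of_nonpos_right (Finset.sum_nonpos fun j hj => ?_)
      refine mul_nonpos_of_nonpos_of_nonneg (hZ k j ?_) (hp j).le
      rintro rfl
      simp [hJ] at hj
      linarith
    refine ⟨?_, hneg⟩
    by_cases hk : q k < 0
    · exact (hneg hk).le
    · refine mul_nonpos_of_nonneg_of_nonpos (not_lt.1 hk) (Finset.sum_nonpos fun j hj => ?_)
      refine mul_nonpos_of_nonpos_of_nonneg (hZ k j ?_) (hp j).le
      rintro rfl
      simp [hJ] at hj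
      exact hk hj
  have h4 : ∑ k, q k * ∑ j ∈ J, Z k j * p j < 0 :=
    Finset.sum_neg' (fun k _ => (h3 k).1) ⟨i, Finset.mem_univ i, (h3 i).2 hi⟩
  linarith

end Matrix


/-! ### Successive interference cancellation within one link. -/

section SIC

variable {d M : ℕ}

/-- The covariance seen by a stream decoded after the streams before `j` have been cancelled. -/
noncomputable def sicCov (Om : Matrix (Fin d) (Fin d) ℂ) (p : Fin M → ℝ) (h : Fin M → Fin d → ℂ)
    (j : ℕ) : Matrix (Fin d) (Fin d) ℂ :=
  Om + ∑ i ∈ Finset.univ.filter (fun i : Fin M => j ≤ (i : ℕ)), (p i : ℂ) • vecMulVec (h i) (star (h i))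

variable {Om : Matrix (Fin d) (Fin d) ℂ} {p : Fin M → ℝ} {h : Fin M → Fin d → ℂ}

theorem posDef_sicCov (hOm : Om.PosDef) (hp : ∀ i, 0 < p i) (j : ℕ) :
    (sicCov Om p h j).PosDef :=
  hOm.add_posSemidef (posSemidef_sum _ fun i _ =>
    (posSemidef_vecMulVec_self_star (h i)).smul (by exact_mod_cast (hp i).le))

theorem sicCov_eq_add (Om : Matrix (Fin d) (Fin d) ℂ) (p : Fin M → ℝ) (h : Fin M → Fin d → ℂ)
    (m : Fin M) : sicCov Om p h m =
      sicCov Om p h (m + 1) + (p m : ℂ) • vecMulVec (h m) (star (h m)) := by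
  have : (Finset.univ.filter fun i : Fin M => (m : ℕ) ≤ i) =
      insert m (Finset.univ.filter fun i : Fin M => (m : ℕ) + 1 ≤ i) := by
    ext i
    simp only [Finset.mem_filter, Finset.mem_univ, true_and, Finset.mem_insert, Fin.ext_iff]
    omega
  rw [sicCov, sicCov, this, Finset.sum_insert (by simp)]
  abel

theorem sicCov_of_le (Om : Matrix (Fin d) (Fin d) ℂ) (p : Fin M → ℝ) (h : Fin M → Fin d → ℂ)
    {j : ℕ} (hj : M ≤ j) : sicCov Om p h j = Om := by
  rw [sicCov, Finset.filter_false_of_mem, Finset.sum_empty, add_zero]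
  intro i _
  omega

theorem Fin.sum_filter_lt_sub {V : Type*} [AddCommGroup V] (f : ℕ → V) {M j : ℕ} (hj : j ≤ M) :
    ∑ n ∈ Finset.univ.filter (fun n : Fin M => (n : ℕ) < j), (f (n + 1) - f n) = f j - f 0 := by
  induction j with
  | zero => simp
  | succ j ih =>
    have : (Finset.univ.filter fun n : Fin M => (n : ℕ) < j + 1) =
        insert ⟨j, hj⟩ (Finset.univ.filter fun n : Fin M => (n : ℕ) < j) := by
      ext i
      simp only [Finset.mem_filter, Finset.mem_univ, true_and, Finset.mem_insert, Fin.ext_iff]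
      omega
    rw [this, Finset.sum_insert (by simp), ih (by omega)]
    simp

/-- Since `A *ᵥ r = α • h`, both the noise form at `r` and the gain are multiples of powers of `g =
h† A⁻¹ h`, and the Sherman-Morrison coefficient can be rewritten through them. The unknown scalar
`α` drops out. -/
theorem mmse_receiver {A : Matrix (Fin d) (Fin d) ℂ} (hA : A.PosDef) {p : ℝ} (hp : 0 < p)
    {h r : Fin d → ℂ} {α : ℂ} (hr : r = α • A⁻¹ *ᵥ h) (hr1 : star r ⬝ᵥ r = 1) :
    0 < formRe A r ∧ 0 < ‖star r ⬝ᵥ h‖ ^ 2 ∧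
    A⁻¹ - (A + (p : ℂ) • vecMulVec h (star h))⁻¹ =
      (p * ‖star r ⬝ᵥ h‖ ^ 2 / (formRe A r * (formRe A r + p * ‖star r ⬝ᵥ h‖ ^ 2))) •
        vecMulVec r (star r) ∧
    formRe (A + (p : ℂ) • vecMulVec h (star h))⁻¹ h =
      ‖star r ⬝ᵥ h‖ ^ 2 / (formRe A r + p * ‖star r ⬝ᵥ h‖ ^ 2) := by
  have hr0 := ne_zero_of_star_dotProduct_self hr1
  have hc : 0 < formRe A r := hA.formRe_pos hr0
  have hα : α ≠ 0 := by rintro rfl; simp [hr] at hr0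
  have hh : h ≠ 0 := by rintro rfl; simp [hr] at hr0
  have hg : 0 < formRe A⁻¹ h := hA.inv.formRe_pos hh
  have hgc := hA.inv.posSemidef.dotProduct_mulVec_eq_formRe h
  set g := formRe A⁻¹ h with hgdef
  have hs : star (A⁻¹ *ᵥ h) = star h ᵥ* A⁻¹ := by rw [star_mulVec, hA.inv.isHermitian.eq]
  have hrh : star r ⬝ᵥ h = star α * g := by
    rw [hr, star_smul, smul_dotProduct, hs, ← dotProduct_mulVec, hgc, smul_eq_mul]
  have hAr : A *ᵥ r = α • h := by
    rw [hr, mulVec_smul, mulVec_mulVec, Matrix.mul_nonsing_inv _ hA.isUnit_det, one_mulVec]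
  have hcα : formRe A r = ‖α‖ ^ 2 * g := by
    rw [formRe, hAr, dotProduct_smul, hrh, smul_eq_mul, ← mul_assoc]
    have : α * star α = ((‖α‖ ^ 2 : ℝ) : ℂ) := by
      rw [Complex.star_def, Complex.mul_conj, Complex.normSq_eq_norm_sq]
    rw [this]
    norm_cast
  have hG : ‖star r ⬝ᵥ h‖ ^ 2 = ‖α‖ ^ 2 * g ^ 2 := by
    rw [hrh, norm_mul, norm_star, Complex.norm_real, Real.norm_of_nonneg hg.le]; ring
  have ha : 0 < ‖α‖ ^ 2 := by positivity
  have hdiff : A⁻¹ - (A + (p : ℂ) • vecMulVec h (star h))⁻¹ =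
      (p * ‖star r ⬝ᵥ h‖ ^ 2 / (formRe A r * (formRe A r + p * ‖star r ⬝ᵥ h‖ ^ 2))) •
        vecMulVec r (star r) := by
    rw [hA.inv_sub_inv_add_vecMulVec hp, hgc]
    have : vecMulVec r (star r) =
        ((‖α‖ ^ 2 : ℝ) : ℂ) • vecMulVec (A⁻¹ *ᵥ h) (star (A⁻¹ *ᵥ h)) := by
      rw [hr, star_smul, smul_vecMulVec, vecMulVec_smul, smul_smul, Complex.star_def,
        Complex.mul_conj, Complex.normSq_eq_norm_sq]
    rw [this, ← Complex.coe_smul, smul_smul, hG, hcα]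
    congr 1
    norm_cast
    field_simp
  refine ⟨hc, by rw [hG]; positivity, hdiff, ?_⟩
  have h1 := congrArg (fun B => formRe B h) hdiff
  simp only [formRe_sub, formRe_smul, formRe_vecMulVec, ← hgdef] at h1
  rw [norm_star_dotProduct_comm h r] at h1
  rw [sub_eq_iff_eq_add, ← sub_eq_iff_eq_add'] at h1
  rw [← h1, hG, hcα]
  field_simp
  ring

/-- The dual power of a stream with power `p`, receive covariance `c` and gain `G`. -/
noncomputable def dualPower (w p c G : ℝ) : ℝ := w * (p * G / (c * (c + p * G)))

variable {r : Fin M → Fin d → ℂ}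

/-- Each summand is `w` times the change of the inverse covariance when one stream is cancelled, so
the sum telescopes. -/
theorem sum_filter_lt_dualPower (hOm : Om.PosDef) (hp : ∀ i, 0 < p i)
    (hr : ∀ m, ∃ α : ℂ, r m = α • (sicCov Om p h (m + 1))⁻¹ *ᵥ h m)
    (hr1 : ∀ m, star (r m) ⬝ᵥ r m = 1) (w : ℝ) {j : ℕ} (hj : j ≤ M) :
    ∑ n ∈ Finset.univ.filter (fun n : Fin M => (n : ℕ) < j), dualPower w (p n) (formRe (sicCov Om p h (n + 1)) (r n))
      (‖star (r n) ⬝ᵥ h n‖ ^ 2) • vecMulVec (r n) (star (r n)) =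
      w • ((sicCov Om p h j)⁻¹ - (sicCov Om p h 0)⁻¹) := by
  rw [← Fin.sum_filter_lt_sub (fun j => (sicCov Om p h j)⁻¹) hj, Finset.smul_sum]
  refine Finset.sum_congr rfl fun n _ => ?_
  obtain ⟨α, hα⟩ := hr n
  rw [sicCov_eq_add Om p h n, (mmse_receiver (posDef_sicCov hOm hp _) (hp n) hα (hr1 n)).2.2.1,
    smul_smul, dualPower]

theorem sum_dualPower (hOm : Om.PosDef) (hp : ∀ i, 0 < p i)
    (hr : ∀ m, ∃ α : ℂ, r m = α • (sicCov Om p h (m + 1))⁻¹ *ᵥ h m)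
    (hr1 : ∀ m, star (r m) ⬝ᵥ r m = 1) (w : ℝ) :
    ∑ n : Fin M, dualPower w (p n) (formRe (sicCov Om p h (n + 1)) (r n))
      (‖star (r n) ⬝ᵥ h n‖ ^ 2) • vecMulVec (r n) (star (r n)) =
      w • (Om⁻¹ - (sicCov Om p h 0)⁻¹) := by
  have := sum_filter_lt_dualPower hOm hp hr hr1 w le_rfl
  rwa [sicCov_of_le Om p h le_rfl, Finset.filter_true_of_mem fun i _ => i.2] at this

/-- The telescoped identity is evaluated as a Hermitian form at `h m`. Its term with `sicCov Om p h
m` is matched with the diagonal term by the last formula of `mmse_receiver`. -/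
theorem dualPower_recursion (hOm : Om.PosDef) (hp : ∀ i, 0 < p i)
    (hr : ∀ m, ∃ α : ℂ, r m = α • (sicCov Om p h (m + 1))⁻¹ *ᵥ h m)
    (hr1 : ∀ m, star (r m) ⬝ᵥ r m = 1) (w : ℝ) (m : Fin M) :
    formRe (sicCov Om p h (m + 1)) (r m) / p m *
        dualPower w (p m) (formRe (sicCov Om p h (m + 1)) (r m)) (‖star (r m) ⬝ᵥ h m‖ ^ 2) -
      ∑ n ∈ Finset.univ.filter (fun n : Fin M => (n : ℕ) < m), ‖star (r n) ⬝ᵥ h m‖ ^ 2 *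
        dualPower w (p n) (formRe (sicCov Om p h (n + 1)) (r n)) (‖star (r n) ⬝ᵥ h n‖ ^ 2) =
      w * formRe (sicCov Om p h 0)⁻¹ (h m) := by
  have h1 := congrArg (fun B => formRe B (h m)) (sum_filter_lt_dualPower hOm hp hr hr1 w m.2.le)
  simp only [formRe_sum, formRe_smul, formRe_sub, formRe_vecMulVec] at h1
  obtain ⟨α, hα⟩ := hr m
  obtain ⟨hc, hG, -, h2⟩ := mmse_receiver (posDef_sicCov hOm hp _) (hp m) hα (hr1 m)
  rw [← sicCov_eq_add Om p h m] at h2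
  rw [h2] at h1
  have h3 : ∑ n ∈ Finset.univ.filter (fun n : Fin M => (n : ℕ) < m), ‖star (r n) ⬝ᵥ h m‖ ^ 2 *
      dualPower w (p n) (formRe (sicCov Om p h (n + 1)) (r n)) (‖star (r n) ⬝ᵥ h n‖ ^ 2) =
      ∑ n ∈ Finset.univ.filter (fun n : Fin M => (n : ℕ) < m),
      dualPower w (p n) (formRe (sicCov Om p h (n + 1)) (r n)) (‖star (r n) ⬝ᵥ h n‖ ^ 2) *
        ‖star (h m) ⬝ᵥ r n‖ ^ 2 :=
    Finset.sum_congr rfl fun n _ => by rw [mul_comm, norm_star_dotProduct_comm (r n) (h m)]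
  rw [h3, h1, dualPower]
  have := hp m
  field_simp
  ring

/-- The triangular recursion determines the dual powers. -/
theorem eq_of_recursion {a q q' b : Fin M → ℝ} {g : Fin M → Fin M → ℝ} (ha : ∀ m, a m ≠ 0)
    (hq : ∀ m, a m * q m - ∑ n ∈ Finset.univ.filter (fun n : Fin M => (n : ℕ) < m), g n m * q n = b m)
    (hq' : ∀ m, a m * q' m - ∑ n ∈ Finset.univ.filter (fun n : Fin M => (n : ℕ) < m), g n m * q' n = b m) : q = q' := by
  have key : ∀ (j : ℕ) (m : Fin M), (m : ℕ) = j → q m = q' m := by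
    intro j
    induction j using Nat.strong_induction_on with
    | _ j ih =>
      intro m hm
      have h1 : ∑ n ∈ Finset.univ.filter (fun n : Fin M => (n : ℕ) < m), g n m * q n =
          ∑ n ∈ Finset.univ.filter (fun n : Fin M => (n : ℕ) < m), g n m * q' n :=
        Finset.sum_congr rfl fun n hn => by
          rw [ih n (by simp at hn; omega) n rfl]
      have h2 := (hq m).trans (hq' m).symm
      rw [h1, sub_left_inj] at h2
      exact mul_left_cancel₀ (ha m) h2
  exact funext fun m => key m m rfl

end SIC

theorem StreamDecomposition.nonempty {L : ℕ} {tx : Fin L → ℕ} {S : CovFamily tx}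
    (hS : ∀ l, (S l).PosSemidef) : Nonempty (StreamDecomposition S) := by
  choose d G hd hG hSG using fun l => (hS l).exists_thin_diagonalization rfl
  refine ⟨⟨fun l => (S l).rank, d, fun l m i => G l i m, hd, fun l m => ?_, fun l => ?_⟩⟩
  · have := congrFun (congrFun (hG l) m) m
    rwa [one_apply_eq] at this
  · conv_lhs => rw [hSG l]
    ext i j
    rw [mul_apply]
    simp only [mul_diagonal, conjTranspose_apply, Matrix.sum_apply, Matrix.smul_apply,
      vecMulVec_apply, Pi.star_apply, smul_eq_mul]
    exact Finset.sum_congr rfl fun m _ => by ring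

/-! ### The covariance transformation of a one-hop network. -/

namespace InterferenceNetwork

variable {L : ℕ} {tx rx : Fin L → ℕ} (N : InterferenceNetwork tx rx) {S : CovFamily tx}
  (dec : StreamDecomposition S) (r : ∀ l : Fin L, Fin (dec.M l) → Fin (rx l) → ℂ)

/-- Interference-plus-noise covariance at the source of link `l` in the reverse links. -/
noncomputable def reverseInterference (Sh : CovFamily rx) : CovFamily tx := fun l =>
  N.What l + ∑ k, N.Φ k l • ((N.H k l).conjTranspose * Sh k * N.H k l)

/-- The covariance in the denominator of the SINR of stream `m` of link `l`. -/
noncomputable def streamCov (l : Fin L) (m : Fin (dec.M l)) : Matrix (Fin (rx l)) (Fin (rx l)) ℂ :=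
  sicCov (N.interference S l) (dec.p l) (fun n => N.H l l *ᵥ dec.t l n) (m + 1)

theorem mul_S_mul_conjTranspose (l k : Fin L) : N.H l k * S k * (N.H l k)ᴴ =
    ∑ n, (dec.p k n : ℂ) • vecMulVec (N.H l k *ᵥ dec.t k n) (star (N.H l k *ᵥ dec.t k n)) := by
  conv_lhs => rw [dec.sum_eq k]
  rw [Matrix.mul_sum, Matrix.sum_mul]
  exact Finset.sum_congr rfl fun n _ => smul_mul_mulVec_vecMulVec_star _ _ _

theorem sicCov_zero (l : Fin L) :
    sicCov (N.interference S l) (dec.p l) (fun n => N.H l l *ᵥ dec.t l n) 0 =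
      N.interference S l + N.H l l * S l * (N.H l l)ᴴ := by
  rw [sicCov, mul_S_mul_conjTranspose N dec]
  simp

theorem streamCov_eq (l : Fin L) (m : Fin (dec.M l)) :
    ∑ i ∈ Finset.Ioi m, N.H l l *
        ((dec.p l i : ℂ) • Matrix.vecMulVec (dec.t l i) (star (dec.t l i))) * (N.H l l)ᴴ
      + N.interference S l = N.streamCov dec l m := by
  rw [streamCov, sicCov, add_comm]
  congr 1
  have : Finset.Ioi m = Finset.univ.filter (fun i : Fin (dec.M l) => (m : ℕ) + 1 ≤ (i : ℕ)) := by
    ext i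
    simp only [Finset.mem_Ioi, Finset.mem_filter, Finset.mem_univ, true_and, Fin.lt_def]
    omega
  rw [this]
  exact Finset.sum_congr rfl fun n _ => smul_mul_mulVec_vecMulVec_star _ _ _

variable {N dec r}

theorem IsReceiver.eq_smul (hr : N.IsReceiver dec r) (l : Fin L) (m : Fin (dec.M l)) :
    ∃ α : ℂ, r l m = α • (N.streamCov dec l m)⁻¹ *ᵥ (N.H l l *ᵥ dec.t l m) := by
  have := (hr l m).1
  rwa [streamCov_eq] at this

theorem exists_isReceiver (hΩ : ∀ l, (N.interference S l).PosDef)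
    (hne : ∀ l m, N.H l l *ᵥ dec.t l m ≠ 0) : ∃ r, N.IsReceiver dec r := by
  have h : ∀ l m, ∃ v : Fin (rx l) → ℂ,
      (∃ α : ℂ, v = α • (N.streamCov dec l m)⁻¹ *ᵥ (N.H l l *ᵥ dec.t l m)) ∧
        star v ⬝ᵥ v = 1 := by
    intro l m
    have hA : (N.streamCov dec l m).PosDef := posDef_sicCov (hΩ l) (dec.power_pos l) _
    have h0 : (N.streamCov dec l m)⁻¹ *ᵥ (N.H l l *ᵥ dec.t l m) ≠ 0 := by
      intro h0
      have h1 := hA.inv.formRe_pos (hne l m)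
      rw [formRe, h0] at h1
      simp at h1
    obtain ⟨α, hα⟩ := exists_smul_star_dotProduct_self h0
    exact ⟨_, ⟨α, rfl⟩, hα⟩
  choose r hr using h
  refine ⟨r, fun l m => ?_⟩
  rw [streamCov_eq]
  exact hr l m

/-- As the coupling vanishes on the diagonal, the case distinction becomes a sum of an intra-link
and an inter-link part that can be summed separately. -/
theorem crosstalk_eq (hd : ∀ l, N.Φ l l = 0) (l k : Fin L) (m : Fin (dec.M l))
    (n : Fin (dec.M k)) : N.crosstalk dec r ⟨l, m⟩ ⟨k, n⟩ =
      (if l = k ∧ (m : ℕ) < (n : ℕ) then N.gain dec r ⟨l, m⟩ ⟨k, n⟩ else 0) +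
        N.Φ l k * N.gain dec r ⟨l, m⟩ ⟨k, n⟩ := by
  rw [crosstalk]
  by_cases h : l = k
  · subst h
    simp [hd]
  · simp [h]

/-- It identifies the SINR denominators, so that the inverse of `sinrMatrix` has the entries `formRe
(streamCov) r / p` and no longer involves the gains. -/
theorem noise_add_sum_crosstalk (hd : ∀ l, N.Φ l l = 0) (l : Fin L) (m : Fin (dec.M l)) :
    formRe (N.W l) (r l m) + ∑ b : dec.Idx, N.crosstalk dec r ⟨l, m⟩ b * dec.p b.1 b.2 =
      formRe (N.streamCov dec l m) (r l m) := by
  rw [Fintype.sum_sigma]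
  simp only [crosstalk_eq hd, add_mul, Finset.sum_add_distrib]
  rw [Finset.sum_eq_single l (fun k _ hk => by simp [hk.symm]) (by simp), streamCov, sicCov,
    interference, formRe_add, formRe_add, formRe_sum, formRe_sum, add_assoc, add_comm (∑ k, _)]
  congr 2
  · refine Finset.sum_congr rfl fun k _ => ?_
    rw [formRe_smul, mul_S_mul_conjTranspose N dec, formRe_sum, Finset.mul_sum]
    refine Finset.sum_congr rfl fun n _ => ?_
    rw [formRe_ofReal_smul, formRe_vecMulVec, gain]
    ring
  · rw [Finset.sum_filter]
    refine Finset.sum_congr rfl fun n _ => ?_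
    rw [formRe_ofReal_smul, formRe_vecMulVec]
    simp only [gain, true_and, ite_mul, zero_mul, Nat.succ_le_iff, mul_comm (dec.p l n)]

/-- The transposed counterpart: a stream hears in reverse the earlier streams of its own link, and
the other links through the reverse interference covariance. -/
theorem sum_crosstalk_mul (hd : ∀ l, N.Φ l l = 0) (q : dec.Idx → ℝ) {Sh : CovFamily rx}
    (hSh : ∀ l, Sh l = ∑ m, (q ⟨l, m⟩ : ℂ) • vecMulVec (r l m) (star (r l m)))
    (l : Fin L) (m : Fin (dec.M l)) :
    ∑ b : dec.Idx, N.crosstalk dec r b ⟨l, m⟩ * q b =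
      ∑ n ∈ Finset.univ.filter (fun n : Fin (dec.M l) => (n : ℕ) < m),
        ‖star (r l n) ⬝ᵥ (N.H l l *ᵥ dec.t l m)‖ ^ 2 * q ⟨l, n⟩ +
      (formRe (N.reverseInterference Sh l) (dec.t l m) - formRe (N.What l) (dec.t l m)) := by
  rw [Fintype.sum_sigma]
  simp only [crosstalk_eq hd, add_mul, Finset.sum_add_distrib]
  rw [Finset.sum_eq_single l (fun k _ hk => by simp [hk]) (by simp), reverseInterference,
    formRe_add, add_sub_cancel_left, formRe_sum]
  congr 1
  · rw [Finset.sum_filter]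
    refine Finset.sum_congr rfl fun n _ => ?_
    simp only [gain, true_and, ite_mul, zero_mul]
  · refine Finset.sum_congr rfl fun k _ => ?_
    rw [formRe_smul, formRe_conjTranspose_mul_mul, hSh, formRe_sum, Finset.mul_sum]
    refine Finset.sum_congr rfl fun n _ => ?_
    rw [formRe_ofReal_smul, formRe_vecMulVec, gain, norm_star_dotProduct_comm]
    ring

theorem IsReceiver.sinrMatrix_eq (hr : N.IsReceiver dec r) (hd : ∀ l, N.Φ l l = 0)
    (hΩ : ∀ l, (N.interference S l).PosDef) : N.sinrMatrix dec r =
      diagonal fun a => dec.p a.1 a.2 / formRe (N.streamCov dec a.1 a.2) (r a.1 a.2) := by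
  rw [sinrMatrix]
  congr 1
  ext ⟨l, m⟩
  obtain ⟨α, hα⟩ := hr.eq_smul l m
  obtain ⟨hc, hG, -⟩ := mmse_receiver (posDef_sicCov (hΩ l) (dec.power_pos l) _)
    (dec.power_pos l m) hα (hr l m).2
  have h := noise_add_sum_crosstalk (N := N) (r := r) hd l m
  rw [formRe] at h
  rw [sinr, h]
  have hG' : N.gain dec r ⟨l, m⟩ ⟨l, m⟩ ≠ 0 := hG.ne'
  field_simp

theorem IsReceiver.formRe_streamCov_pos (hr : N.IsReceiver dec r)
    (hΩ : ∀ l, (N.interference S l).PosDef) (l : Fin L) (m : Fin (dec.M l)) :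
    0 < formRe (N.streamCov dec l m) (r l m) :=
  (posDef_sicCov (hΩ l) (dec.power_pos l) _).formRe_pos
    (ne_zero_of_star_dotProduct_self (hr l m).2)

theorem IsReceiver.isUnit_det_sinrMatrix (hr : N.IsReceiver dec r) (hd : ∀ l, N.Φ l l = 0)
    (hΩ : ∀ l, (N.interference S l).PosDef) : IsUnit (N.sinrMatrix dec r).det := by
  rw [hr.sinrMatrix_eq hd hΩ, det_diagonal]
  exact isUnit_iff_ne_zero.2 (Finset.prod_ne_zero_iff.2 fun a _ =>
    (div_pos (dec.power_pos _ _) (hr.formRe_streamCov_pos hΩ _ _)).ne')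

theorem IsReceiver.sinrMatrix_inv (hr : N.IsReceiver dec r) (hd : ∀ l, N.Φ l l = 0)
    (hΩ : ∀ l, (N.interference S l).PosDef) : (N.sinrMatrix dec r)⁻¹ =
      diagonal fun a => formRe (N.streamCov dec a.1 a.2) (r a.1 a.2) / dec.p a.1 a.2 := by
  rw [hr.sinrMatrix_eq hd hΩ]
  apply inv_eq_right_inv
  rw [diagonal_mul_diagonal, ← diagonal_one]
  congr 1
  ext ⟨l, m⟩
  have h1 := dec.power_pos l m
  have h2 := hr.formRe_streamCov_pos hΩ l m
  simp only
  field_simp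

theorem IsReceiver.offDiag_nonpos (hr : N.IsReceiver dec r) (hd : ∀ l, N.Φ l l = 0)
    (hΦ : ∀ l k, 0 ≤ N.Φ l k) (hΩ : ∀ l, (N.interference S l).PosDef) (a b : dec.Idx)
    (hab : a ≠ b) : ((N.sinrMatrix dec r)⁻¹ - N.crosstalk dec r) a b ≤ 0 := by
  rw [hr.sinrMatrix_inv hd hΩ, Matrix.sub_apply, diagonal_apply_ne _ hab, zero_sub, neg_nonpos]
  have hg : 0 ≤ N.gain dec r a b := sq_nonneg _
  rw [crosstalk_eq hd a.1 b.1 a.2 b.2]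
  exact add_nonneg (by split_ifs <;> [exact hg; exact le_rfl]) (mul_nonneg (hΦ _ _) hg)

/-- On the forward powers, the inverse of the SINR matrix yields noise plus cross-talk; subtracting
the cross-talk leaves the receiver noise, which is positive. -/
theorem IsReceiver.mulVec_power (hr : N.IsReceiver dec r) (hd : ∀ l, N.Φ l l = 0)
    (hW : ∀ l, (N.W l).PosDef) (hΩ : ∀ l, (N.interference S l).PosDef) (a : dec.Idx) :
    0 < (((N.sinrMatrix dec r)⁻¹ - N.crosstalk dec r) *ᵥ fun a => dec.p a.1 a.2) a := by
  rw [hr.sinrMatrix_inv hd hΩ, sub_mulVec, Pi.sub_apply, mulVec_diagonal, mulVec, dotProduct,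
    div_mul_cancel₀ _ (dec.power_pos _ _).ne', ← noise_add_sum_crosstalk hd, add_sub_cancel_right]
  exact (hW _).formRe_pos (ne_zero_of_star_dotProduct_self (hr _ _).2)

theorem IsReceiver.transpose_eq (hr : N.IsReceiver dec r) (hd : ∀ l, N.Φ l l = 0)
    (hΩ : ∀ l, (N.interference S l).PosDef) :
    ((N.sinrMatrix dec r)⁻¹ - N.crosstalk dec r)ᵀ =
      (N.sinrMatrix dec r)⁻¹ - (N.crosstalk dec r)ᵀ := by
  rw [hr.sinrMatrix_inv hd hΩ, transpose_sub, diagonal_transpose]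

theorem IsReceiver.isUnit_det_sub (hr : N.IsReceiver dec r) (hd : ∀ l, N.Φ l l = 0)
    (hΦ : ∀ l k, 0 ≤ N.Φ l k) (hW : ∀ l, (N.W l).PosDef)
    (hΩ : ∀ l, (N.interference S l).PosDef) :
    IsUnit ((N.sinrMatrix dec r)⁻¹ - (N.crosstalk dec r)ᵀ).det := by
  rw [← hr.transpose_eq hd hΩ, det_transpose]
  exact isUnit_det_of_mulVec_pos (hr.offDiag_nonpos hd hΦ hΩ) (fun a => dec.power_pos a.1 a.2)
    (hr.mulVec_power hd hW hΩ)

theorem IsReceiver.mulVec_reversePower (hr : N.IsReceiver dec r) (hd : ∀ l, N.Φ l l = 0)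
    (hΦ : ∀ l k, 0 ≤ N.Φ l k) (hW : ∀ l, (N.W l).PosDef)
    (hΩ : ∀ l, (N.interference S l).PosDef) :
    ((N.sinrMatrix dec r)⁻¹ - (N.crosstalk dec r)ᵀ) *ᵥ N.reversePower dec r =
      N.reverseNoise dec := by
  rw [reversePower, mulVec_mulVec, Matrix.mul_nonsing_inv _ (hr.isUnit_det_sub hd hΦ hW hΩ),
    one_mulVec]

theorem IsReceiver.eq_reversePower (hr : N.IsReceiver dec r) (hd : ∀ l, N.Φ l l = 0)
    (hΦ : ∀ l k, 0 ≤ N.Φ l k) (hW : ∀ l, (N.W l).PosDef)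
    (hΩ : ∀ l, (N.interference S l).PosDef) {q : dec.Idx → ℝ}
    (hq : ((N.sinrMatrix dec r)⁻¹ - (N.crosstalk dec r)ᵀ) *ᵥ q = N.reverseNoise dec) :
    N.reversePower dec r = q := by
  rw [reversePower, ← hq, mulVec_mulVec, Matrix.nonsing_inv_mul _
    (hr.isUnit_det_sub hd hΦ hW hΩ), one_mulVec]

theorem IsReceiver.reversePower_nonneg (hr : N.IsReceiver dec r) (hd : ∀ l, N.Φ l l = 0)
    (hΦ : ∀ l k, 0 ≤ N.Φ l k) (hW : ∀ l, (N.W l).PosDef)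
    (hΩ : ∀ l, (N.interference S l).PosDef) (hWhat : ∀ l, (N.What l).PosDef) (a : dec.Idx) :
    0 ≤ N.reversePower dec r a := by
  refine nonneg_of_transpose_mulVec_nonneg (hr.offDiag_nonpos hd hΦ hΩ)
    (fun a => dec.power_pos a.1 a.2) (hr.mulVec_power hd hW hΩ) (fun b => ?_) a
  rw [hr.transpose_eq hd hΩ, hr.mulVec_reversePower hd hΦ hW hΩ]
  exact (hWhat _).posSemidef.formRe_nonneg _

variable (N dec r) in
/-- The reverse powers that reproduce `w l • (Ω l⁻¹ - (Ω l + H l l * S l * (H l l)†)⁻¹)`. -/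
noncomputable def explicitPower (w : Fin L → ℝ) (a : dec.Idx) : ℝ :=
  dualPower (w a.1) (dec.p a.1 a.2) (formRe (N.streamCov dec a.1 a.2) (r a.1 a.2))
    (N.gain dec r a a)

theorem IsReceiver.sum_explicitPower (hr : N.IsReceiver dec r)
    (hΩ : ∀ l, (N.interference S l).PosDef) (w : Fin L → ℝ) (l : Fin L) :
    ∑ m, (N.explicitPower dec r w ⟨l, m⟩ : ℂ) • vecMulVec (r l m) (star (r l m)) =
      w l • ((N.interference S l)⁻¹ -
        (N.interference S l + N.H l l * S l * (N.H l l)ᴴ)⁻¹) := by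
  rw [← sicCov_zero N dec, ← sum_dualPower (hΩ l) (dec.power_pos l) (hr.eq_smul l)
    (fun m => (hr l m).2) (w l)]
  exact Finset.sum_congr rfl fun m _ => Complex.coe_smul _ _

theorem IsReceiver.explicitPower_recursion (hr : N.IsReceiver dec r)
    (hΩ : ∀ l, (N.interference S l).PosDef) (w : Fin L → ℝ) (l : Fin L) (m : Fin (dec.M l)) :
    formRe (N.streamCov dec l m) (r l m) / dec.p l m * N.explicitPower dec r w ⟨l, m⟩ -
      ∑ n ∈ Finset.univ.filter (fun n : Fin (dec.M l) => (n : ℕ) < m),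
        ‖star (r l n) ⬝ᵥ (N.H l l *ᵥ dec.t l m)‖ ^ 2 * N.explicitPower dec r w ⟨l, n⟩ =
      w l * formRe (N.interference S l + N.H l l * S l * (N.H l l)ᴴ)⁻¹
        (N.H l l *ᵥ dec.t l m) := by
  rw [← sicCov_zero N dec]
  exact dualPower_recursion (hΩ l) (dec.power_pos l) (hr.eq_smul l) (fun m => (hr l m).2) (w l) m

/-- The reverse powers are the explicit ones if each stream satisfies the optimality condition with
respect to the dual covariances. -/
theorem IsReceiver.mulVec_eq_reverseNoise_iff (hr : N.IsReceiver dec r) (hd : ∀ l, N.Φ l l = 0)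
    (hΩ : ∀ l, (N.interference S l).PosDef) (w : Fin L → ℝ) {q : dec.Idx → ℝ} {Sh : CovFamily rx}
    (hSh : ∀ l, Sh l = ∑ m, (q ⟨l, m⟩ : ℂ) • vecMulVec (r l m) (star (r l m)))
    (hopt : ∀ l m, formRe (N.reverseInterference Sh l) (dec.t l m) =
      w l * formRe (N.interference S l + N.H l l * S l * (N.H l l)ᴴ)⁻¹
        (N.H l l *ᵥ dec.t l m)) :
    ((N.sinrMatrix dec r)⁻¹ - (N.crosstalk dec r)ᵀ) *ᵥ q = N.reverseNoise dec ↔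
      q = N.explicitPower dec r w := by
  -- Reverse noise plus inter-link cross-talk is the form of the reverse interference covariance,
  -- which `hopt` replaces by a quantity independent of `q`. This decouples the links.
  have key : ∀ l m, (((N.sinrMatrix dec r)⁻¹ - (N.crosstalk dec r)ᵀ) *ᵥ q) ⟨l, m⟩ =
      N.reverseNoise dec ⟨l, m⟩ ↔
      formRe (N.streamCov dec l m) (r l m) / dec.p l m * q ⟨l, m⟩ -
      ∑ n ∈ Finset.univ.filter (fun n : Fin (dec.M l) => (n : ℕ) < m),
        ‖star (r l n) ⬝ᵥ (N.H l l *ᵥ dec.t l m)‖ ^ 2 * q ⟨l, n⟩ =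
      w l * formRe (N.interference S l + N.H l l * S l * (N.H l l)ᴴ)⁻¹
        (N.H l l *ᵥ dec.t l m) := by
    intro l m
    rw [hr.sinrMatrix_inv hd hΩ, sub_mulVec, Pi.sub_apply, mulVec_diagonal, mulVec, dotProduct]
    simp only [transpose_apply]
    rw [sum_crosstalk_mul hd q hSh, ← hopt]
    change _ = formRe (N.What l) (dec.t l m) ↔ _
    constructor <;> intro h <;> linarith
  constructor
  · intro h
    ext ⟨l, m⟩
    refine congrFun (eq_of_recursion (q := fun m => q ⟨l, m⟩)
      (q' := fun m => N.explicitPower dec r w ⟨l, m⟩)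
      (g := fun n m => ‖star (r l n) ⬝ᵥ (N.H l l *ᵥ dec.t l m)‖ ^ 2)
      (a := fun m => formRe (N.streamCov dec l m) (r l m) / dec.p l m) (fun m => ?_)
      (fun m => (key l m).1 (congrFun h ⟨l, m⟩))
      (fun m => hr.explicitPower_recursion hΩ w l m)) m
    exact (div_pos (hr.formRe_streamCov_pos hΩ l m) (dec.power_pos l m)).ne'
  · rintro rfl
    ext ⟨l, m⟩
    exact (key l m).2 (hr.explicitPower_recursion hΩ w l m)

/-- Complementary slackness holds along every stream. -/
theorem formRe_eq_of_isKKT (dec : StreamDecomposition S) {w : ℝ} {l : Fin L}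
    {Oh : Matrix (Fin (tx l)) (Fin (tx l)) ℂ} {Om : Matrix (Fin (rx l)) (Fin (rx l)) ℂ}
    {H : Matrix (Fin (rx l)) (Fin (tx l)) ℂ} (h : IsKKT w H Om Oh (S l)) (m : Fin (dec.M l)) :
    formRe Oh (dec.t l m) = w * formRe (Om + H * S l * Hᴴ)⁻¹ (H *ᵥ dec.t l m) := by
  set M := Oh - w • (Hᴴ * (Om + H * S l * Hᴴ)⁻¹ * H)
  -- A vanishing trace is here a sum of nonnegative terms with positive weights, so every stream
  -- lies on the zero set of the slack form.
  have h1 : ∑ n, dec.p l n * formRe M (dec.t l n) = (S l * M).trace.re := by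
    conv_rhs => rw [dec.sum_eq l]
    rw [Matrix.sum_mul, trace_sum, Complex.re_sum]
    refine Finset.sum_congr rfl fun n _ => ?_
    rw [Matrix.smul_mul, trace_smul, smul_eq_mul, Complex.re_ofReal_mul, vecMulVec_mul,
      trace_vecMulVec, dotProduct_comm, ← dotProduct_mulVec, formRe]
  rw [h.mul_eq_zero, trace_zero, Complex.zero_re, Finset.sum_eq_zero_iff_of_nonneg
    fun n _ => mul_nonneg (dec.power_pos l n).le (h.posSemidef.formRe_nonneg _)] at h1
  have h2 := (mul_eq_zero.1 (h1 m (Finset.mem_univ m))).resolve_left (dec.power_pos l m).ne'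
  rw [formRe_sub, formRe_smul, formRe_conjTranspose_mul_mul, sub_eq_zero] at h2
  exact h2

end InterferenceNetwork

/-! ### Polite water filling and Type I duals of the relay network. -/

namespace RelayNetwork

variable {N : RelayNetwork} {w : Fin N.L → ℝ} {F : N.Precoding} {S : CovFamily N.tx}
  {Sh : CovFamily N.rx}

theorem reverseInterference_equivalent (Sh : CovFamily N.rx) (l : Fin N.L) :
    (N.equivalent F).reverseInterference Sh l = N.dualOmega (N.dualPrecoding F) Sh l :=
  (N.dualOmega_dualPrecoding F Sh l).symm

theorem exists_isWhitenedSVD (hW : ∀ l, (N.eqNoise F l).PosDef)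
    (hWhat : ∀ l, (N.eqConstraint F l).PosDef) (hS : ∀ l, (S l).PosSemidef)
    (hSh : ∀ l, (Sh l).PosSemidef) (l : Fin N.L) : ∃ E δ G, N.IsWhitenedSVD F S Sh l E δ G := by
  refine exists_isThinSVD ?_
  rw [whitenedChannel, rank_mul_eq_left_of_isUnit_det _ _ (Matrix.isUnit_nonsing_inv_det _
    (posDef_dualOmega hWhat hSh l).isUnit_det_sqrt), rank_mul_eq_right_of_isUnit_det _ _
    (Matrix.isUnit_nonsing_inv_det _ (posDef_Omega hW hS l).isUnit_det_sqrt)]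

/-- Polite water filling is equivalent to the optimality conditions, for every choice of the thin
singular value decomposition. -/
theorem whitenedInput_eq_waterFilling_iff (hW : ∀ l, (N.eqNoise F l).PosDef)
    (hWhat : ∀ l, (N.eqConstraint F l).PosDef) (hw : ∀ l, 0 ≤ w l) (hS : ∀ l, (S l).PosSemidef)
    (hSh : ∀ l, (Sh l).PosSemidef) {l : Fin N.L} {E δ G} (h : N.IsWhitenedSVD F S Sh l E δ G) :
    N.whitenedInput F S Sh l = waterFilling (w l) δ G ↔
      IsKKT (w l) (N.eqChannel F l l) (N.Omega F S l) (N.dualOmega (N.dualPrecoding F) Sh l)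
        (S l) := by
  have hΩ := posDef_Omega hW hS l
  have hΩh := posDef_dualOmega hWhat hSh l
  have key := isKKT_whitened_iff (w := w l) (S := S l) (H := N.eqChannel F l l)
    (isHermitian_sqrt (N.Omega F S l)) (isHermitian_sqrt (N.dualOmega (N.dualPrecoding F) Sh l))
    hΩ.isUnit_det_sqrt hΩh.isUnit_det_sqrt
  rw [hΩ.posSemidef.sqrt_mul_sqrt, hΩh.posSemidef.sqrt_mul_sqrt] at key
  rw [← key]
  have h1 := IsThinSVD.isKKT_waterFilling h (w l)
  constructor
  · intro h2
    rw [← h2] at h1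
    exact h1
  · intro h2
    -- Uniqueness for white noise makes the result independent of the chosen SVD.
    refine h2.unique (hw l) PosDef.one PosDef.one ?_ (posSemidef_waterFilling _ _ _) h1
    have := (hS l).mul_mul_conjTranspose_same (CFC.sqrt (N.dualOmega (N.dualPrecoding F) Sh l))
    rwa [(isHermitian_sqrt _).eq] at this

/-- The KKT system makes the whitened input water filling on `G`; by `IsThinSVD.waterFilling_left`
the water filling on `E` is then the whitened `explicitDual`, and the invertible square roots
cancel. -/
theorem whitenedDualInput_eq_waterFilling_iff (hW : ∀ l, (N.eqNoise F l).PosDef)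
    (hWhat : ∀ l, (N.eqConstraint F l).PosDef) (hw : ∀ l, 0 ≤ w l) (hS : ∀ l, (S l).PosSemidef)
    (hSh : ∀ l, (Sh l).PosSemidef) {l : Fin N.L} {E δ G} (h : N.IsWhitenedSVD F S Sh l E δ G)
    (hK : IsKKT (w l) (N.eqChannel F l l) (N.Omega F S l)
      (N.dualOmega (N.dualPrecoding F) Sh l) (S l)) :
    N.whitenedDualInput F S Sh l = waterFilling (w l) δ E ↔ Sh l = N.explicitDual w F S l := by
  have hΩ := posDef_Omega hW hS l
  have hΩh := posDef_dualOmega hWhat hSh l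
  have hu := hΩ.isUnit_det_sqrt
  have hP := (whitenedInput_eq_waterFilling_iff hW hWhat hw hS hSh h).2 hK
  have key : (1 + N.whitenedChannel F S Sh l * N.whitenedInput F S Sh l *
      (N.whitenedChannel F S Sh l)ᴴ)⁻¹ = _ := whitened_add_inv (S := S l) (N.eqChannel F l l)
    (isHermitian_sqrt (N.Omega F S l)) (isHermitian_sqrt (N.dualOmega (N.dualPrecoding F) Sh l))
    hu hΩh.isUnit_det_sqrt
  rw [hΩ.posSemidef.sqrt_mul_sqrt] at key
  have hE : waterFilling (w l) δ E =
      CFC.sqrt (N.Omega F S l) * N.explicitDual w F S l * CFC.sqrt (N.Omega F S l) := by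
    have h1 : CFC.sqrt (N.Omega F S l) * (N.Omega F S l)⁻¹ * CFC.sqrt (N.Omega F S l) = 1 := by
      have h2 : ∀ R : Matrix (Fin (N.rx l)) (Fin (N.rx l)) ℂ, IsUnit R.det →
          R * (R * R)⁻¹ * R = 1 := fun R hR => by
        rw [Matrix.mul_inv_rev, ← Matrix.mul_assoc, Matrix.mul_nonsing_inv _ hR, Matrix.one_mul,
          Matrix.nonsing_inv_mul _ hR]
      have h3 := h2 _ hu
      rwa [hΩ.posSemidef.sqrt_mul_sqrt] at h3
    rw [← IsThinSVD.waterFilling_left h (w l), ← hP, key, explicitDual, Matrix.mul_smul, Matrix.smul_mul, Matrix.mul_sub, Matrix.sub_mul, h1]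
  rw [hE, whitenedDualInput]
  constructor
  · intro h2
    have hu' : IsUnit (CFC.sqrt (N.Omega F S l)) := (isUnit_iff_isUnit_det _).2 hu
    exact hu'.mul_left_cancel (hu'.mul_right_cancel h2)
  · intro h2
    rw [h2]

theorem isKKT_of_hasPWF (hW : ∀ l, (N.eqNoise F l).PosDef)
    (hWhat : ∀ l, (N.eqConstraint F l).PosDef) (hw : ∀ l, 0 ≤ w l) (hS : ∀ l, (S l).PosSemidef)
    (hSh : ∀ l, (Sh l).PosSemidef) (h : N.HasPWF w F S Sh) (l : Fin N.L) :
    IsKKT (w l) (N.eqChannel F l l) (N.Omega F S l) (N.dualOmega (N.dualPrecoding F) Sh l)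
      (S l) := by
  obtain ⟨E, δ, G, h1, h2⟩ := h l
  exact (whitenedInput_eq_waterFilling_iff hW hWhat hw hS hSh h1).1 h2

/-- The explicit powers satisfy the reverse power equations because their dual covariances are the
ones in the KKT system; nonsingularity makes them the only solution, for any decomposition and any
phases of the receivers. -/
theorem isTypeIDual_iff_of_isStationary (hW : ∀ l, (N.eqNoise F l).PosDef)
    (hWhat : ∀ l, (N.eqConstraint F l).PosDef) (hw : ∀ l, 0 ≤ w l)
    (hst : N.IsStationary w F S) (dec : StreamDecomposition S) (Sh : CovFamily N.rx)
    (Fh : N.Precoding) :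
    N.IsTypeIDual F dec Sh Fh ↔ Sh = N.explicitDual w F S ∧ Fh = N.dualPrecoding F := by
  obtain ⟨hS, hK⟩ := (isStationary_iff w hW hWhat hw).1 hst
  have hSh := posSemidef_explicitDual hw hW hS
  have hΩ : ∀ l, ((N.equivalent F).interference S l).PosDef := posDef_Omega hW hS
  have hopt : ∀ l (m : Fin (dec.M l)),
      formRe (N.dualOmega (N.dualPrecoding F) (N.explicitDual w F S) l) (dec.t l m) =
        w l * formRe (N.Omega F S l + N.eqChannel F l l * S l * (N.eqChannel F l l)ᴴ)⁻¹
          (N.eqChannel F l l *ᵥ dec.t l m) :=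
    fun l m => InterferenceNetwork.formRe_eq_of_isKKT dec (hK l) m
  have hpow : ∀ r, (N.equivalent F).IsReceiver dec r →
      (N.equivalent F).reversePower dec r = (N.equivalent F).explicitPower dec r w := fun r hr =>
    hr.eq_reversePower N.Φ_diag N.Φ_nonneg hW hΩ
      ((hr.mulVec_eq_reverseNoise_iff N.Φ_diag hΩ w (Sh := N.explicitDual w F S)
        (fun l => (hr.sum_explicitPower hΩ w l).symm)
        (fun l m => by rw [reverseInterference_equivalent]; exact hopt l m)).2 rfl)
  refine and_congr_left fun _ => ⟨?_, ?_⟩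
  · rintro ⟨r, hr, -, -, h⟩
    ext1 l
    rw [h, hpow r hr]
    exact hr.sum_explicitPower hΩ w l
  · rintro rfl
    -- A stream in the kernel of its channel would have zero dual interference form by slackness,
    -- contradicting positive definiteness of `dualOmega`. So every receive vector can be
    -- normalized.
    obtain ⟨r, hr⟩ := InterferenceNetwork.exists_isReceiver (dec := dec) hΩ fun l m h0 => by
      have h1 := (posDef_dualOmega hWhat hSh l).formRe_pos
        (ne_zero_of_star_dotProduct_self (dec.unit_norm l m))
      have h0' : N.eqChannel F l l *ᵥ dec.t l m = 0 := h0
      rw [hopt, h0'] at h1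
      simp [formRe] at h1
    refine ⟨r, hr, hr.isUnit_det_sinrMatrix N.Φ_diag hΩ,
      hr.isUnit_det_sub N.Φ_diag N.Φ_nonneg hW hΩ, fun l => ?_⟩
    rw [hpow r hr]
    exact (hr.sum_explicitPower hΩ w l).symm

theorem isStationary_of_hasPWF_explicitDual (hW : ∀ l, (N.eqNoise F l).PosDef)
    (hWhat : ∀ l, (N.eqConstraint F l).PosDef) (hw : ∀ l, 0 ≤ w l) (hS : ∀ l, (S l).PosSemidef)
    (h : N.HasPWF w F S (N.explicitDual w F S)) : N.IsStationary w F S :=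
  (isStationary_iff w hW hWhat hw).2
    ⟨hS, isKKT_of_hasPWF hW hWhat hw hS (posSemidef_explicitDual hw hW hS) h⟩

/-- Here `Ω̂` depends on the unknown `Sh` itself. Nonnegative reverse powers make `Sh` positive
semidefinite, (P) then yields slackness for this same `Ω̂`, and that is just what the triangular
recursion needs. -/
theorem eq_explicitDual_of_isTypeIDual (hW : ∀ l, (N.eqNoise F l).PosDef)
    (hWhat : ∀ l, (N.eqConstraint F l).PosDef) (hw : ∀ l, 0 ≤ w l) (hS : ∀ l, (S l).PosSemidef)
    {dec : StreamDecomposition S} {Fh : N.Precoding} (hT : N.IsTypeIDual F dec Sh Fh)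
    (h : N.HasPWF w F S Sh) : Sh = N.explicitDual w F S := by
  have hΩ : ∀ l, ((N.equivalent F).interference S l).PosDef := posDef_Omega hW hS
  obtain ⟨⟨r, hr, -, -, hShr⟩, -⟩ := hT
  have hSh : ∀ l, (Sh l).PosSemidef := fun l => by
    rw [hShr]
    refine posSemidef_sum _ fun m _ => (posSemidef_vecMulVec_self_star _).smul ?_
    exact_mod_cast hr.reversePower_nonneg N.Φ_diag N.Φ_nonneg hW hΩ hWhat ⟨l, m⟩
  have hK := isKKT_of_hasPWF hW hWhat hw hS hSh h
  have hpow := (hr.mulVec_eq_reverseNoise_iff N.Φ_diag hΩ w hShr (fun l m => by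
      rw [reverseInterference_equivalent]
      exact InterferenceNetwork.formRe_eq_of_isKKT dec (hK l) m)).1
    (hr.mulVec_reversePower N.Φ_diag N.Φ_nonneg hW hΩ)
  ext1 l
  rw [hShr, hpow]
  exact hr.sum_explicitPower hΩ w l

theorem eq_explicitDual_of_hasDualPWF (hW : ∀ l, (N.eqNoise F l).PosDef)
    (hWhat : ∀ l, (N.eqConstraint F l).PosDef) (hw : ∀ l, 0 ≤ w l) (hS : ∀ l, (S l).PosSemidef)
    (hSh : ∀ l, (Sh l).PosSemidef) (h : N.HasPWF w F S Sh) (hD : N.HasDualPWF w F S Sh) :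
    Sh = N.explicitDual w F S := by
  ext1 l
  obtain ⟨E, δ, G, h1, h2⟩ := hD l
  exact (whitenedDualInput_eq_waterFilling_iff hW hWhat hw hS hSh h1
    (isKKT_of_hasPWF hW hWhat hw hS hSh h l)).1 h2

end RelayNetwork

theorem mainTheorem6 (N : RelayNetwork) (w : Fin N.L → ℝ) (hw : ∀ l, 0 ≤ w l)
    (F : N.Precoding)
    (hW : ∀ l, (N.eqNoise F l).PosDef) (hWhat : ∀ l, (N.eqConstraint F l).PosDef) :
    -- every stationary point has the stated dual transformation and structure
    (∀ S : CovFamily N.tx, N.IsStationary w F S →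
      Nonempty (StreamDecomposition S) ∧
      (∀ (dec : StreamDecomposition S) (Sh : CovFamily N.rx) (Fh : N.Precoding),
        N.IsTypeIDual F dec Sh Fh ↔ Sh = N.explicitDual w F S ∧ Fh = N.dualPrecoding F) ∧
      (∀ l, ∃ E δ G, N.IsWhitenedSVD F S (N.explicitDual w F S) l E δ G) ∧
      (∀ l E δ G, N.IsWhitenedSVD F S (N.explicitDual w F S) l E δ G →
        N.whitenedInput F S (N.explicitDual w F S) l = waterFilling (w l) δ G ∧
        N.whitenedDualInput F S (N.explicitDual w F S) l = waterFilling (w l) δ E)) ∧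
    -- conversely, the structure forces stationarity, whichever way the dual covariances are given:
    -- as a Type I dual transformation, by the explicit formula, or by their own structure
    (∀ S : CovFamily N.tx, (∀ l, (S l).PosSemidef) →
      (∀ (dec : StreamDecomposition S) (Sh : CovFamily N.rx),
        N.IsTypeIDual F dec Sh (N.dualPrecoding F) → N.HasPWF w F S Sh →
        N.IsStationary w F S) ∧
      (N.HasPWF w F S (N.explicitDual w F S) → N.IsStationary w F S) ∧
      (∀ Sh : CovFamily N.rx, (∀ l, (Sh l).PosSemidef) →
        N.HasPWF w F S Sh → N.HasDualPWF w F S Sh → N.IsStationary w F S)) := by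
  refine ⟨fun S hst => ?_, fun S hS => ?_⟩
  · obtain ⟨hS, hK⟩ := (RelayNetwork.isStationary_iff w hW hWhat hw).1 hst
    have hSh := RelayNetwork.posSemidef_explicitDual hw hW hS
    exact ⟨StreamDecomposition.nonempty hS,
      RelayNetwork.isTypeIDual_iff_of_isStationary hW hWhat hw hst,
      RelayNetwork.exists_isWhitenedSVD hW hWhat hS hSh,
      fun l E δ G h =>
        ⟨(RelayNetwork.whitenedInput_eq_waterFilling_iff hW hWhat hw hS hSh h).2 (hK l),
          (RelayNetwork.whitenedDualInput_eq_waterFilling_iff hW hWhat hw hS hSh h (hK l)).2 rfl⟩⟩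
  · refine ⟨fun dec Sh hT h => ?_,
      RelayNetwork.isStationary_of_hasPWF_explicitDual hW hWhat hw hS, fun Sh hSh h hD => ?_⟩
    · have := RelayNetwork.eq_explicitDual_of_isTypeIDual hW hWhat hw hS hT h
      rw [this] at h
      exact RelayNetwork.isStationary_of_hasPWF_explicitDual hW hWhat hw hS h
    · have := RelayNetwork.eq_explicitDual_of_hasDualPWF hW hWhat hw hS hSh h hD
      rw [this] at h
      exact RelayNetwork.isStationary_of_hasPWF_explicitDual hW hWhat hw hS h
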